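/- Let $(M,\varphi,\xi,\eta,g)$ be a three-dimensional paracontact metric manifold: $M$ is a smooth $3$-manifold, $\varphi$ a smooth $(1,1)$-tensor, $\xi$ a smooth vector field, $\eta$ a smooth $1$-form and $g$ a smooth pseudo-Riemannian metric with $$\varphi\xi=0,\quad \eta\circ\varphi=0,\quad \eta(\xi)=1,\quad \varphi^2=\mathrm{Id}-\eta\otimes\xi,\quad g(\varphi X,\varphi Y)=-g(X,Y)+\eta(X)\eta(Y),\quad d\eta(X,Y)=g(X,\varphi Y),$$ where $2\,d\eta(X,Y)=X(\eta(Y))-Y(\eta(X))-\eta([X,Y])$, and the eigenspaces of $\varphi|_{\ker\eta}$ for the eigenvalues $1$ and $-1$ have equal dimension. Let $\nabla$ be the Levi-Civita connection of $g$ and $(\mathcal L_\xi\nabla)(X,Y)=[\xi,\nabla_XY]-\nabla_{[\xi,X]}Y-\nabla_X[\xi,Y]$. A local $\varphi$-basis is a local pseudo-orthonormal frame $\{\xi,e,\varphi e\}$ with $\xi,e$ space-like and $\varphi e$ time-like. Then the Reeb field $\xi$ is an infinitesimal harmonic transformation, that is, the metric trace $\mathrm{tr}_g(\mathcal L_\xi\nabla)$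 vanishes on $M$, if and only if every point of $M$ has an open neighbourhood $U$ with a smooth $\varphi$-basis $\{\xi,e,\varphi e\}$, smooth functions $a_1,a_3,a_4,a_5$ on $U$ and a sign $\varepsilon=\pm1$ such that, on $U$, $$[\xi,e]=-\varepsilon a_1e+(a_3-a_1+1)\varphi e,\qquad [\xi,\varphi e]=(a_3+a_1+1)e+\varepsilon a_1\varphi e,\qquad [e,\varphi e]=-2\xi+a_4e-a_5\varphi e,$$ and $$\xi(a_4)-e(a_3)+\varepsilon a_1a_4-a_5(a_3-a_1+1)=0,$$ $$\xi(a_5)-(\varphi e)(a_3)-\varepsilon a_1a_5-a_4(a_3+a_1+1)=0,$$ $$e(a_1)+\varepsilon\,(\varphi e)(a_1)+2\varepsilon a_1a_4+2a_1a_5=0.$$ Here the sign $\varepsilon$ is a function $U\to\{1,-1\}$, constant in a neighbourhood of each point of $U$ at which $a_1\neq0$ and of each point of $U$ near which $a_1$ vanishes identically; it may jump only at boundary points of the zero set of $a_1$. -/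

import Mathlib

open Bundle Set Filter
open scoped Manifold ContDiff Topology

noncomputable section

section Definitions

variable {E : Type*} [NormedAddCommGroup E] [NormedSpace ℝ E]
  {M : Type*} [TopologicalSpace M] [ChartedSpace E M] [IsManifold 𝓘(ℝ, E) ∞ M]

/-- The vector field `X` is smooth at the point `p`. -/
def SmoothFieldAt (X : ∀ x : M, TangentSpace 𝓘(ℝ, E) x) (p : M) : Prop :=
  ContMDiffAt 𝓘(ℝ, E) 𝓘(ℝ, E).tangent ∞
    (fun x ↦ (⟨x, X x⟩ : TangentBundle 𝓘(ℝ, E) M)) p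

/-- The vector field `X` is smooth on the set `U`. -/
def SmoothFieldOn (X : ∀ x : M, TangentSpace 𝓘(ℝ, E) x) (U : Set M) : Prop :=
  ContMDiffOn 𝓘(ℝ, E) 𝓘(ℝ, E).tangent ∞
    (fun x ↦ (⟨x, X x⟩ : TangentBundle 𝓘(ℝ, E) M)) U

/-- The derivative `X(f)` of a function along a vector field. -/
def fieldDeriv (X : ∀ x : M, TangentSpace 𝓘(ℝ, E) x) (f : M → ℝ) (p : M) : ℝ :=
  mvfderiv 𝓘(ℝ, E) f p (X p)

set_option linter.unusedSectionVars false

lemma fieldDeriv_add (X : ∀ x : M, TangentSpace 𝓘(ℝ, E) x) {f h : M → ℝ} {p : M}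
    (hf : MDifferentiableAt 𝓘(ℝ, E) 𝓘(ℝ, ℝ) f p) (hh : MDifferentiableAt 𝓘(ℝ, E) 𝓘(ℝ, ℝ) h p) :
    fieldDeriv X (fun x ↦ f x + h x) p = fieldDeriv X f p + fieldDeriv X h p := by
  simp only [fieldDeriv, mvfderiv_fun_add hf hh, add_apply]

lemma fieldDeriv_mul (X : ∀ x : M, TangentSpace 𝓘(ℝ, E) x) {f h : M → ℝ} {p : M}
    (hf : MDifferentiableAt 𝓘(ℝ, E) 𝓘(ℝ, ℝ) f p) (hh : MDifferentiableAt 𝓘(ℝ, E) 𝓘(ℝ, ℝ) h p) :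
    fieldDeriv X (fun x ↦ f x * h x) p = f p * fieldDeriv X h p + h p * fieldDeriv X f p := by
  simp [fieldDeriv, mvfderiv_fun_mul hf hh]

/-- The Lie bracket `[X, Y]` of vector fields. -/
abbrev fieldBracket (X Y : ∀ x : M, TangentSpace 𝓘(ℝ, E) x) : ∀ x : M, TangentSpace 𝓘(ℝ, E) x :=
  VectorField.mlieBracket 𝓘(ℝ, E) X Y

variable (E M) in
/-- A smooth pseudo-Riemannian metric. -/
structure PseudoRiemannianMetric where
  /-- The scalar product on each tangent space. -/
  inner (x : M) : TangentSpace 𝓘(ℝ, E) x →L[ℝ] TangentSpace 𝓘(ℝ, E) x →L[ℝ] ℝ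
  symm (x : M) (v w : TangentSpace 𝓘(ℝ, E) x) : inner x v w = inner x w v
  nondegenerate (x : M) (v : TangentSpace 𝓘(ℝ, E) x) : (∀ w, inner x v w = 0) → v = 0
  contMDiff : ContMDiff 𝓘(ℝ, E) (𝓘(ℝ, E).prod 𝓘(ℝ, E →L[ℝ] E →L[ℝ] ℝ)) ∞
    (fun x ↦ TotalSpace.mk' (E →L[ℝ] E →L[ℝ] ℝ)
      (E := fun x : M ↦ TangentSpace 𝓘(ℝ, E) x →L[ℝ] TangentSpace 𝓘(ℝ, E) x →L[ℝ] ℝ)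
      x (inner x))

namespace PseudoRiemannianMetric

variable (g : PseudoRiemannianMetric E M)

/-- The right-hand side of the Koszul formula for `2 g(∇_X Y, Z)`. -/
def koszul (X Y Z : ∀ x : M, TangentSpace 𝓘(ℝ, E) x) (p : M) : ℝ :=
  fieldDeriv X (fun x ↦ g.inner x (Y x) (Z x)) p
    + fieldDeriv Y (fun x ↦ g.inner x (X x) (Z x)) p
    - fieldDeriv Z (fun x ↦ g.inner x (X x) (Y x)) p
    + g.inner p (fieldBracket X Y p) (Z p)
    - g.inner p (fieldBracket X Z p) (Y p)
    - g.inner p (fieldBracket Y Z p) (X p)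

/-- The Levi-Civita connection `∇_X Y` of `g`: at the point `p` it is the vector `v` with
`2 g(v, Z) = koszul X Y Z` for every `Z` smooth at `p`. -/
def leviCivita (X Y : ∀ x : M, TangentSpace 𝓘(ℝ, E) x) (p : M) : TangentSpace 𝓘(ℝ, E) p :=
  Classical.epsilon fun v : TangentSpace 𝓘(ℝ, E) p ↦
    ∀ Z : ∀ x : M, TangentSpace 𝓘(ℝ, E) x, SmoothFieldAt Z p →
      2 * g.inner p v (Z p) = g.koszul X Y Z p

lemma mdifferentiableAt_inner {Y Z : ∀ x : M, TangentSpace 𝓘(ℝ, E) x} {p : M}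
    (hY : MDifferentiableAt 𝓘(ℝ, E) 𝓘(ℝ, E).tangent (fun x ↦ (⟨x, Y x⟩ : TangentBundle 𝓘(ℝ, E) M)) p)
    (hZ : MDifferentiableAt 𝓘(ℝ, E) 𝓘(ℝ, E).tangent (fun x ↦ (⟨x, Z x⟩ : TangentBundle 𝓘(ℝ, E) M)) p) :
    MDifferentiableAt 𝓘(ℝ, E) 𝓘(ℝ, ℝ) (fun x ↦ g.inner x (Y x) (Z x)) p := by
  have : MDifferentiableAt 𝓘(ℝ, E) (𝓘(ℝ, E).prod 𝓘(ℝ))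
      (fun m ↦ TotalSpace.mk' ℝ (E := Bundle.Trivial M ℝ) m (g.inner m (Y m) (Z m))) p := by
    apply MDifferentiableAt.clm_bundle_apply₂ (F₁ := E) (F₂ := E)
    · exact g.contMDiff.mdifferentiableAt (by simp)
    · exact hY
    · exact hZ
  simp only [mdifferentiableAt_totalSpace] at this
  exact this.2

lemma koszul_tensorial [FiniteDimensional ℝ E] {X Y : ∀ x : M, TangentSpace 𝓘(ℝ, E) x} {p : M}
    (hX : SmoothFieldAt X p) (hY : SmoothFieldAt Y p) :
    TensorialAt 𝓘(ℝ, E) E (fun Z ↦ g.koszul X Y Z p) p where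
  smul {f Z} hf hZ := by
    have : IsManifold 𝓘(ℝ, E) 2 M := IsManifold.of_le (n := ∞) (by norm_cast)
    have : CompleteSpace E := FiniteDimensional.complete ℝ E
    have hX' := hX.mdifferentiableAt (by simp)
    have hY' := hY.mdifferentiableAt (by simp)
    have e1 : ∀ W : ∀ x : M, TangentSpace 𝓘(ℝ, E) x, (fun x ↦ g.inner x (W x) ((f • Z) x)) = fun x ↦ f x * g.inner x (W x) (Z x) := by
      intro W; ext x; simp
    simp only [koszul, e1]
    rw [fieldDeriv_mul X hf (g.mdifferentiableAt_inner hY' hZ), fieldDeriv_mul Y hf (g.mdifferentiableAt_inner hX' hZ)]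
    simp only [fieldBracket]
    rw [VectorField.mlieBracket_smul_right hf hZ, VectorField.mlieBracket_smul_right hf hZ]
    simp only [fieldDeriv, map_add, map_smul, Pi.smul_apply', add_apply, smul_apply, smul_eq_mul, g.symm p (Z p)]
    ring
  add {Z W} hZ hW := by
    have : IsManifold 𝓘(ℝ, E) 2 M := IsManifold.of_le (n := ∞) (by norm_cast)
    have : CompleteSpace E := FiniteDimensional.complete ℝ E
    have hX' := hX.mdifferentiableAt (by simp)
    have hY' := hY.mdifferentiableAt (by simp)
    have e1 : ∀ V : ∀ x : M, TangentSpace 𝓘(ℝ, E) x, (fun x ↦ g.inner x (V x) ((Z + W) x)) = fun x ↦ g.inner x (V x) (Z x) + g.inner x (V x) (W x) := by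
      intro W; ext x; simp
    simp only [koszul, e1]
    rw [fieldDeriv_add X (g.mdifferentiableAt_inner hY' hZ) (g.mdifferentiableAt_inner hY' hW), fieldDeriv_add Y (g.mdifferentiableAt_inner hX' hZ) (g.mdifferentiableAt_inner hX' hW)]
    simp only [fieldBracket]
    rw [VectorField.mlieBracket_add_right hZ hW, VectorField.mlieBracket_add_right hZ hW]
    simp only [fieldDeriv, map_add, Pi.add_apply, add_apply]
    ring

/-- The Koszul formula characterizes the Levi-Civita connection: the vector chosen in its
definition exists. -/
theorem leviCivita_spec [FiniteDimensional ℝ E] {X Y : ∀ x : M, TangentSpace 𝓘(ℝ, E) x} {p : M}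
    (hX : SmoothFieldAt X p) (hY : SmoothFieldAt Y p) {Z : ∀ x : M, TangentSpace 𝓘(ℝ, E) x}
    (hZ : SmoothFieldAt Z p) :
    2 * g.inner p (g.leviCivita X Y p) (Z p) = g.koszul X Y Z p := by
  have key : ∃ v : TangentSpace 𝓘(ℝ, E) p, ∀ Z : ∀ x : M, TangentSpace 𝓘(ℝ, E) x, SmoothFieldAt Z p →
      2 * g.inner p v (Z p) = g.koszul X Y Z p := by
    have : IsManifold 𝓘(ℝ, E) 1 M := IsManifold.of_le (n := ∞) (by norm_cast)
    let L := TensorialAt.mkHom _ p (g.koszul_tensorial hX hY)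
    have : FiniteDimensional ℝ (TangentSpace 𝓘(ℝ, E) p) := inferInstanceAs (FiniteDimensional ℝ E)
    let B : TangentSpace 𝓘(ℝ, E) p →ₗ[ℝ] (TangentSpace 𝓘(ℝ, E) p →ₗ[ℝ] ℝ) :=
      { toFun := fun v ↦ (g.inner p v).toLinearMap
        map_add' := fun v w ↦ by ext; simp
        map_smul' := fun c v ↦ by ext; simp }
    have hB : Function.Injective B := by
      rw [injective_iff_map_eq_zero]
      intro v hv
      exact g.nondegenerate p v fun w ↦ LinearMap.congr_fun hv w
    have hs : Function.Surjective B :=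
      (LinearMap.injective_iff_surjective_of_finrank_eq_finrank
        (Subspace.dual_finrank_eq (K := ℝ)).symm).1 hB
    obtain ⟨v, hv⟩ := hs ((1 / 2 : ℝ) • L.toLinearMap)
    refine ⟨v, fun Z hZ ↦ ?_⟩
    have h1 : g.inner p v (Z p) = (1 / 2 : ℝ) * L (Z p) := LinearMap.congr_fun hv (Z p)
    have h2 : L (Z p) = g.koszul X Y Z p :=
      TensorialAt.mkHom_apply (g.koszul_tensorial hX hY) (hZ.mdifferentiableAt (by simp))
    rw [h1, h2]; ring
  exact Classical.epsilon_spec key Z hZ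

/-- The Lie derivative of the Levi-Civita connection on vector fields,
`(L_V ∇)(X, Y) = [V, ∇_X Y] - ∇_{[V, X]} Y - ∇_X [V, Y]`. -/
def lieConnection (V X Y : ∀ x : M, TangentSpace 𝓘(ℝ, E) x) (p : M) : TangentSpace 𝓘(ℝ, E) p :=
  fieldBracket V (g.leviCivita X Y) p - g.leviCivita (fieldBracket V X) Y p
    - g.leviCivita X (fieldBracket V Y) p

/-- The value `(L_V ∇)(v, w)` on tangent vectors at `p`, computed on vector fields that extend
`v` and `w` and are smooth near `p`. -/
def lieConnectionAt (V : ∀ x : M, TangentSpace 𝓘(ℝ, E) x) (p : M)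
    (v w : TangentSpace 𝓘(ℝ, E) p) : TangentSpace 𝓘(ℝ, E) p :=
  g.lieConnection V (FiberBundle.extend E v) (FiberBundle.extend E w) p

/-- The Gram matrix of `g` at `p` in a basis of the tangent space. -/
def gram {ι : Type*} (p : M) (b : ι → TangentSpace 𝓘(ℝ, E) p) : Matrix ι ι ℝ :=
  Matrix.of fun i j ↦ g.inner p (b i) (b j)

/-- The metric trace `tr (L_V ∇) = ∑ g^{ij} (L_V ∇)(b_i, b_j)` at `p`, for a basis `b` of the
tangent space at `p`. -/
def traceLieConnection [FiniteDimensional ℝ E] (V : ∀ x : M, TangentSpace 𝓘(ℝ, E) x) (p : M) :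
    TangentSpace 𝓘(ℝ, E) p :=
  let b : Module.Basis (Fin (Module.finrank ℝ E)) ℝ (TangentSpace 𝓘(ℝ, E) p) :=
    Module.finBasis ℝ E
  ∑ i, ∑ j, (g.gram p b)⁻¹ i j • g.lieConnectionAt V p (b i) (b j)

/-- `V` is an infinitesimal harmonic transformation: `tr (L_V ∇) = 0`. -/
def IsInfinitesimalHarmonic [FiniteDimensional ℝ E]
    (V : ∀ x : M, TangentSpace 𝓘(ℝ, E) x) : Prop :=
  ∀ p, g.traceLieConnection V p = 0

end PseudoRiemannianMetric

variable (E M) in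
/-- An almost paracontact structure `(φ, ξ, η)`. The eigenvectors of `φ` for the eigenvalues
`1, -1` lie in `ker η`, so the last field says that `φ` restricts to an almost paracomplex
structure on `ker η`. -/
structure AlmostParacontactStructure where
  φ (x : M) : TangentSpace 𝓘(ℝ, E) x →L[ℝ] TangentSpace 𝓘(ℝ, E) x
  ξ (x : M) : TangentSpace 𝓘(ℝ, E) x
  η (x : M) : TangentSpace 𝓘(ℝ, E) x →L[ℝ] ℝ
  contMDiff_φ : ContMDiff 𝓘(ℝ, E) (𝓘(ℝ, E).prod 𝓘(ℝ, E →L[ℝ] E)) ∞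
    (fun x ↦ TotalSpace.mk' (E →L[ℝ] E)
      (E := fun x : M ↦ TangentSpace 𝓘(ℝ, E) x →L[ℝ] TangentSpace 𝓘(ℝ, E) x) x (φ x))
  contMDiff_ξ : SmoothFieldOn ξ univ
  contMDiff_η : ContMDiff 𝓘(ℝ, E) (𝓘(ℝ, E).prod 𝓘(ℝ, E →L[ℝ] ℝ)) ∞
    (fun x ↦ TotalSpace.mk' (E →L[ℝ] ℝ)
      (E := fun x : M ↦ TangentSpace 𝓘(ℝ, E) x →L[ℝ] ℝ) x (η x))
  φ_ξ (x : M) : φ x (ξ x) = 0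
  η_φ (x : M) (v : TangentSpace 𝓘(ℝ, E) x) : η x (φ x v) = 0
  η_ξ (x : M) : η x (ξ x) = 1
  φ_φ (x : M) (v : TangentSpace 𝓘(ℝ, E) x) : φ x (φ x v) = v - η x v • ξ x
  finrank_eigenspace (x : M) :
    Module.finrank ℝ (Module.End.eigenspace (φ x : Module.End ℝ (TangentSpace 𝓘(ℝ, E) x)) 1)
      = Module.finrank ℝ
        (Module.End.eigenspace (φ x : Module.End ℝ (TangentSpace 𝓘(ℝ, E) x)) (-1))

/-- The exterior derivative of a `1`-form evaluated on vector fields, with the convention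
`2 dη(X, Y) = X(η(Y)) - Y(η(X)) - η([X, Y])`. -/
def extDerivForm (η : ∀ x : M, TangentSpace 𝓘(ℝ, E) x →L[ℝ] ℝ)
    (X Y : ∀ x : M, TangentSpace 𝓘(ℝ, E) x) (p : M) : ℝ :=
  (1 / 2 : ℝ) * (fieldDeriv X (fun x ↦ η x (Y x)) p - fieldDeriv Y (fun x ↦ η x (X x)) p
    - η p (fieldBracket X Y p))

variable (E M) in
/-- A paracontact metric structure `(φ, ξ, η, g)`: the metric is compatible with the almost
paracontact structure and `dη(X, Y) = g(X, φ Y)`. -/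
structure ParacontactMetricStructure extends AlmostParacontactStructure E M where
  g : PseudoRiemannianMetric E M
  compatible (x : M) (v w : TangentSpace 𝓘(ℝ, E) x) :
    g.inner x (φ x v) (φ x w) = - g.inner x v w + η x v * η x w
  extDeriv_η (p : M) (X Y : ∀ x : M, TangentSpace 𝓘(ℝ, E) x) :
    SmoothFieldAt X p → SmoothFieldAt Y p →
      extDerivForm η X Y p = g.inner p (X p) (φ p (Y p))

/-- In dimension three: `{ξ, e, φ e}` is a smooth `φ`-basis on `U`, that is, a pseudo-orthonormal
frame with `ξ`, `e` space-like and `φ e` time-like. -/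
structure ParacontactMetricStructure.IsPhiBasisOn (S : ParacontactMetricStructure E M)
    (e : ∀ x : M, TangentSpace 𝓘(ℝ, E) x) (U : Set M) : Prop where
  smooth : SmoothFieldOn e U
  ξ_ξ : ∀ x ∈ U, S.g.inner x (S.ξ x) (S.ξ x) = 1
  e_e : ∀ x ∈ U, S.g.inner x (e x) (e x) = 1
  φe_φe : ∀ x ∈ U, S.g.inner x (S.φ x (e x)) (S.φ x (e x)) = -1
  ξ_e : ∀ x ∈ U, S.g.inner x (S.ξ x) (e x) = 0
  ξ_φe : ∀ x ∈ U, S.g.inner x (S.ξ x) (S.φ x (e x)) = 0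
  e_φe : ∀ x ∈ U, S.g.inner x (e x) (S.φ x (e x)) = 0

end Definitions

end

/-! On the contact distribution `φ` reverses the sign of `g`, so a space-like vector exists there;
extended, projected along `ξ` and normalized, it gives a local `φ`-basis `ξ, e, f = φ e` near every
point. The contact condition fixes the `ξ`-components of the three brackets, and the `ξ`-component
of the Jacobi identity makes `ad ξ` trace-free on the span of `e, f`. Hence `[ξ, e] = A e + B f`,
`[ξ, f] = C e - A f`, `[e, f] = -2 ξ + a₄ e - a₅ f`, with `B = a₃ - a₁ + 1` and `C = a₃ + a₁ + 1`.

Since `L_ξ ∇` is tensorial and symmetric, its metric trace can be computed in this frame. Koszul's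
formula, with Jacobi eliminating `ξ(a₄)` and `ξ(a₅)`, shows that the trace vanishes iff `A² = a₁²`
and two first order equations for `e(A)` and `f(A)` hold (`traceLieConnection_eq_zero_iff`).
Inserted into the rest of the Jacobi identity, these give the equations for `ξ(a₄)` and `ξ(a₅)`.

It remains to write `A = -ε a₁`. Where `ε` is locally constant, both first order equations become
the single equation for `a₁`. Away from the frontier of the zero set of `a₁` the sign can be chosen
locally constant: by continuity where `a₁ ≠ 0`, arbitrarily where `a₁` vanishes nearby. These points
are dense, and continuity carries the equations to the frontier: in the converse
(`traceLieConnection_eq_zero`) each trace equation is a closed condition; in the direct implication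
(`exists_sign`) the product of the equations for the two signs vanishes everywhere, so at each
frontier point some sign works. -/

/-! ### Smooth fields, directional derivatives and Lie brackets -/

section FieldCalculus

set_option linter.unusedSectionVars false

variable {E : Type*} [NormedAddCommGroup E] [NormedSpace ℝ E]
  {M : Type*} [TopologicalSpace M] [ChartedSpace E M] [IsManifold 𝓘(ℝ, E) ∞ M]
  {X Y Z W : ∀ x : M, TangentSpace 𝓘(ℝ, E) x} {f h : M → ℝ} {U : Set M} {p : M}

lemma SmoothFieldOn.smoothFieldAt (hX : SmoothFieldOn X U) (hU : IsOpen U) (hp : p ∈ U) :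
    SmoothFieldAt X p :=
  (hX p hp).contMDiffAt (hU.mem_nhds hp)

lemma SmoothFieldAt.mdifferentiableAt_section (hX : SmoothFieldAt X p) :
    MDifferentiableAt 𝓘(ℝ, E) 𝓘(ℝ, E).tangent
      (fun x ↦ (⟨x, X x⟩ : TangentBundle 𝓘(ℝ, E) M)) p :=
  hX.mdifferentiableAt (by simp)

lemma SmoothFieldOn.mdifferentiableAt_section (hX : SmoothFieldOn X U) (hU : IsOpen U)
    (hp : p ∈ U) :
    MDifferentiableAt 𝓘(ℝ, E) 𝓘(ℝ, E).tangent
      (fun x ↦ (⟨x, X x⟩ : TangentBundle 𝓘(ℝ, E) M)) p :=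
  (hX.smoothFieldAt hU hp).mdifferentiableAt_section

lemma ContMDiffOn.mdifferentiableAt_of_isOpen (hf : ContMDiffOn 𝓘(ℝ, E) 𝓘(ℝ, ℝ) ∞ f U)
    (hU : IsOpen U) (hp : p ∈ U) : MDifferentiableAt 𝓘(ℝ, E) 𝓘(ℝ, ℝ) f p :=
  ((hf p hp).contMDiffAt (hU.mem_nhds hp)).mdifferentiableAt (by simp)

lemma SmoothFieldOn.mono {V : Set M} (hX : SmoothFieldOn X U) (h : V ⊆ U) : SmoothFieldOn X V :=
  ContMDiffOn.mono hX h

lemma SmoothFieldOn.congr (hX : SmoothFieldOn X U) (h : ∀ x ∈ U, Y x = X x) :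
    SmoothFieldOn Y U :=
  ContMDiffOn.congr hX fun x hx ↦ by rw [h x hx]

lemma SmoothFieldOn.add (hX : SmoothFieldOn X U) (hY : SmoothFieldOn Y U) :
    SmoothFieldOn (X + Y) U :=
  ContMDiffOn.add_section hX hY

lemma SmoothFieldOn.smul (hX : SmoothFieldOn X U) (hf : ContMDiffOn 𝓘(ℝ, E) 𝓘(ℝ, ℝ) ∞ f U) :
    SmoothFieldOn (f • X) U :=
  ContMDiffOn.smul_section hf hX

lemma SmoothFieldOn.bracket [FiniteDimensional ℝ E] (hX : SmoothFieldOn X U)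
    (hY : SmoothFieldOn Y U) (hU : IsOpen U) : SmoothFieldOn (fieldBracket X Y) U := by
  have : IsManifold 𝓘(ℝ, E) (minSmoothness ℝ 2) M := by
    simp only [minSmoothness_of_isRCLikeNormedField]
    exact IsManifold.of_le (n := ∞) (by norm_cast)
  have : IsManifold 𝓘(ℝ, E) (((⊤ : ℕ∞) : ℕ∞ω) + 1) M := ‹IsManifold 𝓘(ℝ, E) ∞ M›
  have : CompleteSpace E := FiniteDimensional.complete ℝ E
  intro x hx
  refine (ContMDiffAt.mlieBracket_vectorField (m := ⊤) (n := ⊤) (hX.smoothFieldAt hU hx)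
    (hY.smoothFieldAt hU hx) ?_).contMDiffWithinAt
  simp only [minSmoothness_of_isRCLikeNormedField]
  exact le_rfl

lemma SmoothFieldOn.clm_apply
    {T : ∀ x : M, TangentSpace 𝓘(ℝ, E) x →L[ℝ] TangentSpace 𝓘(ℝ, E) x}
    (hT : ContMDiff 𝓘(ℝ, E) (𝓘(ℝ, E).prod 𝓘(ℝ, E →L[ℝ] E)) ∞
      (fun x ↦ TotalSpace.mk' (E →L[ℝ] E)
        (E := fun x : M ↦ TangentSpace 𝓘(ℝ, E) x →L[ℝ] TangentSpace 𝓘(ℝ, E) x) x (T x)))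
    (hX : SmoothFieldOn X U) : SmoothFieldOn (fun x ↦ T x (X x)) U :=
  ContMDiffOn.clm_bundle_apply (F₁ := E) (F₂ := E) hT.contMDiffOn hX

lemma SmoothFieldOn.form_apply
    {η : ∀ x : M, TangentSpace 𝓘(ℝ, E) x →L[ℝ] ℝ}
    (hη : ContMDiff 𝓘(ℝ, E) (𝓘(ℝ, E).prod 𝓘(ℝ, E →L[ℝ] ℝ)) ∞
      (fun x ↦ TotalSpace.mk' (E →L[ℝ] ℝ)
        (E := fun x : M ↦ TangentSpace 𝓘(ℝ, E) x →L[ℝ] ℝ) x (η x)))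
    (hX : SmoothFieldOn X U) : ContMDiffOn 𝓘(ℝ, E) 𝓘(ℝ, ℝ) ∞ (fun x ↦ η x (X x)) U := by
  intro x hx
  have : ContMDiffWithinAt 𝓘(ℝ, E) (𝓘(ℝ, E).prod 𝓘(ℝ)) ∞
      (fun m ↦ TotalSpace.mk' ℝ (E := Bundle.Trivial M ℝ) m (η m (X m))) U x :=
    ContMDiffWithinAt.clm_bundle_apply (F₁ := E) (F₂ := ℝ) (hη x).contMDiffWithinAt (hX x hx)
  exact (contMDiffWithinAt_totalSpace.1 this).2

lemma PseudoRiemannianMetric.contMDiffOn_inner (g : PseudoRiemannianMetric E M)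
    (hX : SmoothFieldOn X U) (hY : SmoothFieldOn Y U) :
    ContMDiffOn 𝓘(ℝ, E) 𝓘(ℝ, ℝ) ∞ (fun x ↦ g.inner x (X x) (Y x)) U := by
  intro x hx
  have : ContMDiffWithinAt 𝓘(ℝ, E) (𝓘(ℝ, E).prod 𝓘(ℝ)) ∞
      (fun m ↦ TotalSpace.mk' ℝ (E := Bundle.Trivial M ℝ) m (g.inner m (X m) (Y m))) U x := by
    apply ContMDiffWithinAt.clm_bundle_apply₂ (F₁ := E) (F₂ := E)
    · exact (g.contMDiff x).contMDiffWithinAt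
    · exact hX x hx
    · exact hY x hx
  exact (contMDiffWithinAt_totalSpace.1 this).2

lemma exists_smoothFieldOn_extend (v : TangentSpace 𝓘(ℝ, E) p) :
    ∃ U : Set M, IsOpen U ∧ p ∈ U ∧ SmoothFieldOn (FiberBundle.extend E v) U := by
  obtain ⟨s, hs, hsv⟩ := FiberBundle.exists_contMDiffOn_extend (k := ∞) 𝓘(ℝ, E) E v
  obtain ⟨U, hUs, hU, hp⟩ := mem_nhds_iff.1 hs
  exact ⟨U, hU, hp, hsv.mono hUs⟩

lemma smoothFieldAt_extend (v : TangentSpace 𝓘(ℝ, E) p) :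
    SmoothFieldAt (FiberBundle.extend E v) p := by
  obtain ⟨U, hU, hp, h⟩ := exists_smoothFieldOn_extend v
  exact h.smoothFieldAt hU hp

lemma fieldDeriv_congr (hfh : f =ᶠ[𝓝 p] h) : fieldDeriv X f p = fieldDeriv X h p := by
  simp only [fieldDeriv, mvfderiv, hfh.mfderiv_eq]
  rfl

lemma fieldDeriv_eqOn (hU : IsOpen U) (hp : p ∈ U) (hfh : ∀ x ∈ U, f x = h x) :
    fieldDeriv X f p = fieldDeriv X h p :=
  fieldDeriv_congr (hU.eventually_mem hp |>.mono hfh)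

@[simp] lemma fieldDeriv_const (c : ℝ) : fieldDeriv X (fun _ ↦ c) p = 0 := by
  simp [fieldDeriv, mvfderiv_const]

lemma fieldDeriv_eq_zero_of_eqOn_const {c : ℝ} (hU : IsOpen U) (hp : p ∈ U)
    (hf : ∀ x ∈ U, f x = c) : fieldDeriv X f p = 0 := by
  rw [fieldDeriv_eqOn hU hp hf, fieldDeriv_const]

lemma fieldDeriv_field_add : fieldDeriv (X + Y) f p = fieldDeriv X f p + fieldDeriv Y f p := by
  simp [fieldDeriv]

lemma fieldDeriv_field_smul : fieldDeriv (h • X) f p = h p * fieldDeriv X f p := by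
  simp [fieldDeriv]

lemma fieldBracket_congr (hU : IsOpen U) (hp : p ∈ U) (hX : ∀ x ∈ U, X x = Z x)
    (hY : ∀ x ∈ U, Y x = W x) : fieldBracket X Y p = fieldBracket Z W p :=
  Filter.EventuallyEq.mlieBracket_vectorField_eq (hU.eventually_mem hp |>.mono hX)
    (hU.eventually_mem hp |>.mono hY)

lemma fieldBracket_swap : fieldBracket X Y p = -fieldBracket Y X p :=
  VectorField.mlieBracket_swap_apply

section Bracket

variable [FiniteDimensional ℝ E]

lemma fieldBracket_smul_right (hf : MDifferentiableAt 𝓘(ℝ, E) 𝓘(ℝ, ℝ) f p)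
    (hY : MDifferentiableAt 𝓘(ℝ, E) 𝓘(ℝ, E).tangent
      (fun x ↦ (⟨x, Y x⟩ : TangentBundle 𝓘(ℝ, E) M)) p) :
    fieldBracket X (f • Y) p = fieldDeriv X f p • Y p + f p • fieldBracket X Y p := by
  have : IsManifold 𝓘(ℝ, E) 2 M := IsManifold.of_le (n := ∞) (by norm_cast)
  have : CompleteSpace E := FiniteDimensional.complete ℝ E
  exact VectorField.mlieBracket_smul_right hf hY

lemma fieldBracket_smul_left (hf : MDifferentiableAt 𝓘(ℝ, E) 𝓘(ℝ, ℝ) f p)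
    (hX : MDifferentiableAt 𝓘(ℝ, E) 𝓘(ℝ, E).tangent
      (fun x ↦ (⟨x, X x⟩ : TangentBundle 𝓘(ℝ, E) M)) p) :
    fieldBracket (f • X) Y p = -fieldDeriv Y f p • X p + f p • fieldBracket X Y p := by
  have : IsManifold 𝓘(ℝ, E) 2 M := IsManifold.of_le (n := ∞) (by norm_cast)
  have : CompleteSpace E := FiniteDimensional.complete ℝ E
  exact VectorField.mlieBracket_smul_left hf hX

lemma fieldBracket_add_right
    (hY : MDifferentiableAt 𝓘(ℝ, E) 𝓘(ℝ, E).tangent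
      (fun x ↦ (⟨x, Y x⟩ : TangentBundle 𝓘(ℝ, E) M)) p)
    (hZ : MDifferentiableAt 𝓘(ℝ, E) 𝓘(ℝ, E).tangent
      (fun x ↦ (⟨x, Z x⟩ : TangentBundle 𝓘(ℝ, E) M)) p) :
    fieldBracket X (Y + Z) p = fieldBracket X Y p + fieldBracket X Z p := by
  have : IsManifold 𝓘(ℝ, E) 2 M := IsManifold.of_le (n := ∞) (by norm_cast)
  have : CompleteSpace E := FiniteDimensional.complete ℝ E
  exact VectorField.mlieBracket_add_right hY hZ

lemma fieldBracket_add_left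
    (hX : MDifferentiableAt 𝓘(ℝ, E) 𝓘(ℝ, E).tangent
      (fun x ↦ (⟨x, X x⟩ : TangentBundle 𝓘(ℝ, E) M)) p)
    (hZ : MDifferentiableAt 𝓘(ℝ, E) 𝓘(ℝ, E).tangent
      (fun x ↦ (⟨x, Z x⟩ : TangentBundle 𝓘(ℝ, E) M)) p) :
    fieldBracket (X + Z) Y p = fieldBracket X Y p + fieldBracket Z Y p := by
  have : IsManifold 𝓘(ℝ, E) 2 M := IsManifold.of_le (n := ∞) (by norm_cast)
  have : CompleteSpace E := FiniteDimensional.complete ℝ E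
  exact VectorField.mlieBracket_add_left hX hZ

lemma fieldBracket_jacobi (hX : SmoothFieldAt X p) (hY : SmoothFieldAt Y p)
    (hZ : SmoothFieldAt Z p) :
    fieldBracket X (fieldBracket Y Z) p
      = fieldBracket (fieldBracket X Y) Z p + fieldBracket Y (fieldBracket X Z) p := by
  have h3 : minSmoothness ℝ 3 = 3 := minSmoothness_of_isRCLikeNormedField
  have h2 : minSmoothness ℝ 2 = 2 := minSmoothness_of_isRCLikeNormedField
  have : IsManifold 𝓘(ℝ, E) (minSmoothness ℝ 3) M := by
    rw [h3]; exact IsManifold.of_le (n := ∞) (by norm_cast)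
  have : CompleteSpace E := FiniteDimensional.complete ℝ E
  have hle : minSmoothness ℝ 2 ≤ ∞ := by rw [h2]; norm_cast
  exact VectorField.leibniz_identity_mlieBracket_apply (hX.of_le hle) (hY.of_le hle)
    (hZ.of_le hle)

/-- The derivative of a smooth function along a smooth field is smooth, where there is a field
of constant nonzero length. -/
lemma PseudoRiemannianMetric.contMDiffOn_fieldDeriv (g : PseudoRiemannianMetric E M) {c : ℝ}
    (hU : IsOpen U) (hc : c ≠ 0) (hX : SmoothFieldOn X U) (hY : SmoothFieldOn Y U)
    (hYY : ∀ x ∈ U, g.inner x (Y x) (Y x) = c) (hf : ContMDiffOn 𝓘(ℝ, E) 𝓘(ℝ, ℝ) ∞ f U) :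
    ContMDiffOn 𝓘(ℝ, E) 𝓘(ℝ, ℝ) ∞ (fieldDeriv X f) U := by
  -- Pairing `[X, f Y] = X(f) Y + f [X, Y]` with `Y` and dividing by `g(Y, Y) = c` expresses `X(f)`
  -- through brackets and inner products, whose smoothness is known.
  have h1 := g.contMDiffOn_inner (hX.bracket (hY.smul hf) hU) hY
  have h2 := hf.mul (g.contMDiffOn_inner (hX.bracket hY hU) hY)
  refine ((contMDiffOn_const (c := c⁻¹)).mul (h1.sub h2)).congr fun x hx ↦ ?_
  change fieldDeriv X f x = c⁻¹ * (g.inner x (fieldBracket X (f • Y) x) (Y x)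
    - f x * g.inner x (fieldBracket X Y x) (Y x))
  rw [fieldBracket_smul_right (hf.mdifferentiableAt_of_isOpen hU hx)
    (hY.mdifferentiableAt_section hU hx)]
  simp only [map_add, map_smul, add_apply, smul_apply, smul_eq_mul, hYY x hx]
  field_simp
  ring

end Bracket

end FieldCalculus

/-! ### The Levi-Civita connection and its Lie derivative on vector fields -/

namespace PseudoRiemannianMetric

section Connection

set_option linter.unusedSectionVars false

variable {E : Type*} [NormedAddCommGroup E] [NormedSpace ℝ E] [FiniteDimensional ℝ E]
  {M : Type*} [TopologicalSpace M] [ChartedSpace E M] [IsManifold 𝓘(ℝ, E) ∞ M]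
  (g : PseudoRiemannianMetric E M)
  {V X Y Z W : ∀ x : M, TangentSpace 𝓘(ℝ, E) x} {f : M → ℝ} {U : Set M} {p : M}

lemma ext_inner {v w : TangentSpace 𝓘(ℝ, E) p} (h : ∀ u, g.inner p v u = g.inner p w u) :
    v = w := by
  rw [← sub_eq_zero]
  exact g.nondegenerate p _ fun u ↦ by simp [h u]

lemma mdifferentiableAt_inner_of_smoothFieldAt (hX : SmoothFieldAt X p) (hY : SmoothFieldAt Y p) :
    MDifferentiableAt 𝓘(ℝ, E) 𝓘(ℝ, ℝ) (fun x ↦ g.inner x (X x) (Y x)) p :=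
  g.mdifferentiableAt_inner hX.mdifferentiableAt_section hY.mdifferentiableAt_section

/-- Every tangent vector is the value of a smooth field, so nondegeneracy leaves only one vector
with the Koszul property. Identities for `∇` thus reduce to identities for `koszul`. -/
lemma eq_leviCivita (hX : SmoothFieldAt X p) (hY : SmoothFieldAt Y p)
    {v : TangentSpace 𝓘(ℝ, E) p}
    (h : ∀ Z : ∀ x : M, TangentSpace 𝓘(ℝ, E) x, SmoothFieldAt Z p →
      2 * g.inner p v (Z p) = g.koszul X Y Z p) : g.leviCivita X Y p = v := by
  refine g.ext_inner fun u ↦ ?_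
  have h1 := g.leviCivita_spec hX hY (smoothFieldAt_extend u)
  have h2 := h _ (smoothFieldAt_extend u)
  rw [FiberBundle.extend_apply_self] at h1 h2
  linarith

lemma koszul_congr (hU : IsOpen U) (hp : p ∈ U) (hX : ∀ x ∈ U, X x = V x)
    (hY : ∀ x ∈ U, Y x = W x) : g.koszul X Y Z p = g.koszul V W Z p := by
  simp only [koszul]
  rw [fieldBracket_congr hU hp hX hY, fieldBracket_congr hU hp hX (fun _ _ ↦ rfl),
    fieldBracket_congr hU hp hY (fun _ _ ↦ rfl),
    fieldDeriv_eqOn hU hp (f := fun x ↦ g.inner x (Y x) (Z x))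
      (h := fun x ↦ g.inner x (W x) (Z x)) (fun x hx ↦ by rw [hY x hx]),
    fieldDeriv_eqOn hU hp (f := fun x ↦ g.inner x (X x) (Z x))
      (h := fun x ↦ g.inner x (V x) (Z x)) (fun x hx ↦ by rw [hX x hx]),
    fieldDeriv_eqOn hU hp (f := fun x ↦ g.inner x (X x) (Y x))
      (h := fun x ↦ g.inner x (V x) (W x))
      (fun x hx ↦ by rw [hX x hx, hY x hx]), hX p hp, hY p hp]
  simp only [fieldDeriv, hX p hp, hY p hp]

lemma leviCivita_congr (hU : IsOpen U) (hp : p ∈ U) (hX : ∀ x ∈ U, X x = V x)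
    (hY : ∀ x ∈ U, Y x = W x) : g.leviCivita X Y p = g.leviCivita V W p := by
  -- The defining predicates coincide, hence so do the chosen vectors; no smoothness enters.
  simp only [leviCivita, g.koszul_congr hU hp hX hY]

lemma koszul_add_left (hX : SmoothFieldAt X p) (hV : SmoothFieldAt V p)
    (hY : SmoothFieldAt Y p) (hZ : SmoothFieldAt Z p) :
    g.koszul (X + V) Y Z p = g.koszul X Y Z p + g.koszul V Y Z p := by
  simp only [koszul]
  rw [fieldBracket_add_left hX.mdifferentiableAt_section hV.mdifferentiableAt_section,
    fieldBracket_add_left hX.mdifferentiableAt_section hV.mdifferentiableAt_section,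
    fieldDeriv_field_add]
  simp only [Pi.add_apply, map_add, add_apply]
  rw [fieldDeriv_add _ (g.mdifferentiableAt_inner_of_smoothFieldAt hX hZ)
      (g.mdifferentiableAt_inner_of_smoothFieldAt hV hZ),
    fieldDeriv_add _ (g.mdifferentiableAt_inner_of_smoothFieldAt hX hY)
      (g.mdifferentiableAt_inner_of_smoothFieldAt hV hY)]
  ring

lemma koszul_smul_left (hf : MDifferentiableAt 𝓘(ℝ, E) 𝓘(ℝ, ℝ) f p) (hX : SmoothFieldAt X p)
    (hY : SmoothFieldAt Y p) (hZ : SmoothFieldAt Z p) :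
    g.koszul (f • X) Y Z p = f p * g.koszul X Y Z p := by
  simp only [koszul]
  rw [fieldBracket_smul_left hf hX.mdifferentiableAt_section,
    fieldBracket_smul_left hf hX.mdifferentiableAt_section, fieldDeriv_field_smul]
  simp only [Pi.smul_apply', map_add, map_smul, add_apply, smul_apply, smul_eq_mul]
  rw [fieldDeriv_mul _ hf (g.mdifferentiableAt_inner_of_smoothFieldAt hX hZ),
    fieldDeriv_mul _ hf (g.mdifferentiableAt_inner_of_smoothFieldAt hX hY)]
  ring

lemma koszul_swap : g.koszul X Y Z p - g.koszul Y X Z p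
    = 2 * g.inner p (fieldBracket X Y p) (Z p) := by
  simp only [koszul]
  rw [fieldBracket_swap (X := Y) (Y := X)]
  simp only [g.symm _ (Y _) (X _), map_neg, neg_apply]
  ring

/-- Through this identity the rules for the second argument of `∇` follow from those for the first.
-/
lemma leviCivita_torsion (hX : SmoothFieldAt X p) (hY : SmoothFieldAt Y p) :
    g.leviCivita X Y p = g.leviCivita Y X p + fieldBracket X Y p := by
  refine g.eq_leviCivita hX hY fun Z hZ ↦ ?_
  have h := g.leviCivita_spec hY hX hZ
  have := g.koszul_swap (X := X) (Y := Y) (Z := Z) (p := p)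
  simp only [map_add, add_apply]
  linarith

lemma leviCivita_add_left (hU : IsOpen U) (hp : p ∈ U) (hX : SmoothFieldOn X U)
    (hV : SmoothFieldOn V U) (hY : SmoothFieldOn Y U) :
    g.leviCivita (X + V) Y p = g.leviCivita X Y p + g.leviCivita V Y p := by
  have hX' := hX.smoothFieldAt hU hp
  have hV' := hV.smoothFieldAt hU hp
  have hY' := hY.smoothFieldAt hU hp
  refine g.eq_leviCivita ((hX.add hV).smoothFieldAt hU hp) hY' fun Z hZ ↦ ?_
  rw [g.koszul_add_left hX' hV' hY' hZ, ← g.leviCivita_spec hX' hY' hZ,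
    ← g.leviCivita_spec hV' hY' hZ]
  simp only [map_add, add_apply]
  ring

lemma leviCivita_smul_left (hU : IsOpen U) (hp : p ∈ U)
    (hf : ContMDiffOn 𝓘(ℝ, E) 𝓘(ℝ, ℝ) ∞ f U) (hX : SmoothFieldOn X U)
    (hY : SmoothFieldOn Y U) :
    g.leviCivita (f • X) Y p = f p • g.leviCivita X Y p := by
  have hX' := hX.smoothFieldAt hU hp
  have hY' := hY.smoothFieldAt hU hp
  refine g.eq_leviCivita ((hX.smul hf).smoothFieldAt hU hp) hY' fun Z hZ ↦ ?_
  rw [g.koszul_smul_left (hf.mdifferentiableAt_of_isOpen hU hp) hX' hY' hZ,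
    ← g.leviCivita_spec hX' hY' hZ]
  simp only [map_smul, smul_apply, smul_eq_mul]
  ring

lemma leviCivita_add_right (hU : IsOpen U) (hp : p ∈ U) (hX : SmoothFieldOn X U)
    (hV : SmoothFieldOn V U) (hY : SmoothFieldOn Y U) :
    g.leviCivita Y (X + V) p = g.leviCivita Y X p + g.leviCivita Y V p := by
  rw [g.leviCivita_torsion (hY.smoothFieldAt hU hp) ((hX.add hV).smoothFieldAt hU hp),
    g.leviCivita_torsion (hY.smoothFieldAt hU hp) (hX.smoothFieldAt hU hp),
    g.leviCivita_torsion (hY.smoothFieldAt hU hp) (hV.smoothFieldAt hU hp),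
    g.leviCivita_add_left hU hp hX hV hY, fieldBracket_add_right
      (hX.mdifferentiableAt_section hU hp) (hV.mdifferentiableAt_section hU hp)]
  abel

lemma leviCivita_smul_right (hU : IsOpen U) (hp : p ∈ U)
    (hf : ContMDiffOn 𝓘(ℝ, E) 𝓘(ℝ, ℝ) ∞ f U) (hX : SmoothFieldOn X U)
    (hY : SmoothFieldOn Y U) :
    g.leviCivita Y (f • X) p = fieldDeriv Y f p • X p + f p • g.leviCivita Y X p := by
  rw [g.leviCivita_torsion (hY.smoothFieldAt hU hp) ((hX.smul hf).smoothFieldAt hU hp),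
    g.leviCivita_torsion (hY.smoothFieldAt hU hp) (hX.smoothFieldAt hU hp),
    g.leviCivita_smul_left hU hp hf hX hY, fieldBracket_smul_right
      (hf.mdifferentiableAt_of_isOpen hU hp) (hX.mdifferentiableAt_section hU hp), smul_add]
  abel

lemma lieConnection_congr (hU : IsOpen U) (hp : p ∈ U) {X' Y' : ∀ x : M, TangentSpace 𝓘(ℝ, E) x}
    (hX : ∀ x ∈ U, X x = X' x) (hY : ∀ x ∈ U, Y x = Y' x) :
    g.lieConnection V X Y p = g.lieConnection V X' Y' p := by
  simp only [lieConnection]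
  rw [fieldBracket_congr hU hp (fun _ _ ↦ rfl)
      (fun x hx ↦ g.leviCivita_congr hU hx hX hY),
    g.leviCivita_congr hU hp
      (fun x hx ↦ fieldBracket_congr hU hx (fun _ _ ↦ rfl) hX) hY,
    g.leviCivita_congr hU hp hX
      (fun x hx ↦ fieldBracket_congr hU hx (fun _ _ ↦ rfl) hY)]

/-- `∇_X Y` is smooth on `U` for all fields `X, Y` smooth on `U`. -/
def SmoothConnectionOn (U : Set M) : Prop :=
  ∀ X Y : ∀ x : M, TangentSpace 𝓘(ℝ, E) x, SmoothFieldOn X U → SmoothFieldOn Y U →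
    SmoothFieldOn (g.leviCivita X Y) U

variable {g} in
-- As `∇` is torsion-free, the difference of the two sides is `[V, [X, Y]] - [[V, X], Y] - [X, [V,
-- Y]]`, which vanishes by Jacobi.
lemma SmoothConnectionOn.lieConnection_symm (hg : g.SmoothConnectionOn U) (hU : IsOpen U)
    (hp : p ∈ U) (hV : SmoothFieldOn V U) (hX : SmoothFieldOn X U) (hY : SmoothFieldOn Y U) :
    g.lieConnection V X Y p = g.lieConnection V Y X p := by
  have hXY : ∀ x ∈ U, g.leviCivita X Y x = (g.leviCivita Y X + fieldBracket X Y) x :=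
    fun x hx ↦ g.leviCivita_torsion (hX.smoothFieldAt hU hx) (hY.smoothFieldAt hU hx)
  have hVX := (hV.bracket hX hU).smoothFieldAt hU hp
  have hVY := (hV.bracket hY hU).smoothFieldAt hU hp
  have hX' := hX.smoothFieldAt hU hp
  have hY' := hY.smoothFieldAt hU hp
  simp only [lieConnection]
  rw [fieldBracket_congr (X := V) hU hp (fun _ _ ↦ rfl) hXY,
    fieldBracket_add_right ((hg Y X hY hX).mdifferentiableAt_section hU hp)
      ((hX.bracket hY hU).mdifferentiableAt_section hU hp),
    fieldBracket_jacobi (hV.smoothFieldAt hU hp) hX' hY',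
    g.leviCivita_torsion hVX hY', g.leviCivita_torsion hX' hVY]
  abel

variable {g} in
lemma SmoothConnectionOn.lieConnection_add_left (hg : g.SmoothConnectionOn U) (hU : IsOpen U)
    (hp : p ∈ U) (hV : SmoothFieldOn V U) (hX : SmoothFieldOn X U) (hW : SmoothFieldOn W U)
    (hY : SmoothFieldOn Y U) :
    g.lieConnection V (X + W) Y p = g.lieConnection V X Y p + g.lieConnection V W Y p := by
  have h1 : ∀ x ∈ U, g.leviCivita (X + W) Y x = (g.leviCivita X Y + g.leviCivita W Y) x :=
    fun x hx ↦ g.leviCivita_add_left hU hx hX hW hY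
  have h2 : ∀ x ∈ U, fieldBracket V (X + W) x = (fieldBracket V X + fieldBracket V W) x :=
    fun x hx ↦ fieldBracket_add_right (hX.mdifferentiableAt_section hU hx)
      (hW.mdifferentiableAt_section hU hx)
  simp only [lieConnection]
  rw [fieldBracket_congr (X := V) hU hp (fun _ _ ↦ rfl) h1,
    fieldBracket_add_right ((hg X Y hX hY).mdifferentiableAt_section hU hp)
      ((hg W Y hW hY).mdifferentiableAt_section hU hp),
    g.leviCivita_congr (Y := Y) hU hp h2 (fun _ _ ↦ rfl),
    g.leviCivita_add_left hU hp (hV.bracket hX hU) (hV.bracket hW hU) hY,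
    g.leviCivita_add_left hU hp hX hW (hV.bracket hY hU)]
  abel

variable {g} in
-- The term `V(f) ∇_X Y` produced by the outer bracket cancels the one from `∇_{[V, f X]} Y`. With
-- symmetry this makes `L_V ∇` tensorial in both arguments.
lemma SmoothConnectionOn.lieConnection_smul_left (hg : g.SmoothConnectionOn U) (hU : IsOpen U)
    (hp : p ∈ U) (hV : SmoothFieldOn V U) (hf : ContMDiffOn 𝓘(ℝ, E) 𝓘(ℝ, ℝ) ∞ f U)
    (hVf : ContMDiffOn 𝓘(ℝ, E) 𝓘(ℝ, ℝ) ∞ (fieldDeriv V f) U)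
    (hX : SmoothFieldOn X U) (hY : SmoothFieldOn Y U) :
    g.lieConnection V (f • X) Y p = f p • g.lieConnection V X Y p := by
  have h1 : ∀ x ∈ U, g.leviCivita (f • X) Y x = (f • g.leviCivita X Y) x :=
    fun x hx ↦ g.leviCivita_smul_left hU hx hf hX hY
  have h2 : ∀ x ∈ U, fieldBracket V (f • X) x = (fieldDeriv V f • X + f • fieldBracket V X) x :=
    fun x hx ↦ fieldBracket_smul_right (hf.mdifferentiableAt_of_isOpen hU hx)
      (hX.mdifferentiableAt_section hU hx)
  simp only [lieConnection]
  rw [fieldBracket_congr (X := V) hU hp (fun _ _ ↦ rfl) h1,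
    fieldBracket_smul_right (hf.mdifferentiableAt_of_isOpen hU hp)
      ((hg X Y hX hY).mdifferentiableAt_section hU hp),
    g.leviCivita_congr (Y := Y) hU hp h2 (fun _ _ ↦ rfl),
    g.leviCivita_add_left hU hp (hX.smul hVf) ((hV.bracket hX hU).smul hf) hY,
    g.leviCivita_smul_left hU hp hVf hX hY,
    g.leviCivita_smul_left hU hp hf (hV.bracket hX hU) hY,
    g.leviCivita_smul_left hU hp hf hX (hV.bracket hY hU)]
  module

end Connection

end PseudoRiemannianMetric

/-! ### Pseudo-orthonormal frames and the metric trace -/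

namespace PseudoRiemannianMetric

section Frame

set_option linter.unusedSectionVars false

variable {E : Type*} [NormedAddCommGroup E] [NormedSpace ℝ E] [FiniteDimensional ℝ E]
  {M : Type*} [TopologicalSpace M] [ChartedSpace E M] [IsManifold 𝓘(ℝ, E) ∞ M]
  {g : PseudoRiemannianMetric E M}
  {V X Y Z W : ∀ x : M, TangentSpace 𝓘(ℝ, E) x} {f : M → ℝ} {U : Set M} {p : M}
  {ι : Type*} [Fintype ι] [DecidableEq ι] {F : ι → ∀ x : M, TangentSpace 𝓘(ℝ, E) x} {σ : ι → ℝ}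

variable (g) in
/-- The fields `F i` form a smooth pseudo-orthonormal frame on `U` with signs `σ i`. -/
structure IsOrthonormalFrameOn (F : ι → ∀ x : M, TangentSpace 𝓘(ℝ, E) x) (σ : ι → ℝ)
    (U : Set M) : Prop where
  smooth (i : ι) : SmoothFieldOn (F i) U
  sign_mul_self (i : ι) : σ i * σ i = 1
  inner (x : M) (hx : x ∈ U) (i j : ι) : g.inner x (F i x) (F j x) = if i = j then σ i else 0
  card_eq : Fintype.card ι = Module.finrank ℝ E

namespace IsOrthonormalFrameOn

variable (hF : g.IsOrthonormalFrameOn F σ U)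
include hF

lemma mono {U' : Set M} (h : U' ⊆ U) : g.IsOrthonormalFrameOn F σ U' :=
  ⟨fun i ↦ (hF.smooth i).mono h, hF.sign_mul_self, fun x hx ↦ hF.inner x (h hx), hF.card_eq⟩

lemma linearIndependent (hp : p ∈ U) : LinearIndependent ℝ (fun i ↦ F i p) := by
  rw [Fintype.linearIndependent_iff]
  intro c hc i
  have h := congrArg (fun v ↦ g.inner p v (F i p)) hc
  simp only [map_sum, map_smul, sum_apply, smul_apply, smul_eq_mul,
    hF.inner p hp, map_zero, zero_apply] at h
  simp only [mul_ite, mul_zero, Finset.sum_ite_eq', Finset.mem_univ, if_true] at h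
  have := hF.sign_mul_self i
  rcases mul_eq_zero.1 h with h | h
  · exact h
  · simp [h] at this

/-- The frame as a basis of the tangent space at a point of `U`. -/
noncomputable def basis (hp : p ∈ U) : Module.Basis ι ℝ (TangentSpace 𝓘(ℝ, E) p) :=
  haveI : FiniteDimensional ℝ (TangentSpace 𝓘(ℝ, E) p) :=
    inferInstanceAs (FiniteDimensional ℝ E)
  Module.Basis.mk (hF.linearIndependent hp)
    ((hF.linearIndependent hp).span_eq_top_of_card_eq_finrank' hF.card_eq).ge

@[simp] lemma basis_apply (hp : p ∈ U) (i : ι) : hF.basis hp i = F i p := by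
  simp [basis]

lemma basis_repr (hp : p ∈ U) (v : TangentSpace 𝓘(ℝ, E) p) (i : ι) :
    (hF.basis hp).repr v i = σ i * g.inner p v (F i p) := by
  have h := congrArg (fun v ↦ g.inner p v (F i p)) ((hF.basis hp).sum_repr v)
  simp only [map_sum, map_smul, sum_apply, smul_apply, smul_eq_mul,
    basis_apply, hF.inner p hp] at h
  simp only [mul_ite, mul_zero, Finset.sum_ite_eq', Finset.mem_univ, if_true] at h
  rw [← h, mul_comm, mul_assoc, hF.sign_mul_self, mul_one]

lemma eq_sum (hp : p ∈ U) (v : TangentSpace 𝓘(ℝ, E) p) :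
    v = ∑ i, (σ i * g.inner p v (F i p)) • F i p := by
  conv_lhs => rw [← (hF.basis hp).sum_repr v]
  simp only [basis_apply, basis_repr]

lemma ext_inner_frame (hp : p ∈ U) {v w : TangentSpace 𝓘(ℝ, E) p}
    (h : ∀ i, g.inner p v (F i p) = g.inner p w (F i p)) : v = w := by
  rw [hF.eq_sum hp v, hF.eq_sum hp w]
  simp only [h]

omit hF [DecidableEq ι] in
lemma smoothFieldOn_sum {c : ι → M → ℝ} {F : ι → ∀ x : M, TangentSpace 𝓘(ℝ, E) x}
    (hF : ∀ i, SmoothFieldOn (F i) U)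
    (hc : ∀ i, ContMDiffOn 𝓘(ℝ, E) 𝓘(ℝ, ℝ) ∞ (c i) U) (s : Finset ι) :
    SmoothFieldOn (∑ i ∈ s, c i • F i) U := by
  classical
  induction s using Finset.induction_on with
  | empty =>
    rw [Finset.sum_empty]
    exact contMDiffOn_zeroSection ℝ (TangentSpace 𝓘(ℝ, E) : M → Type _)
  | insert i s hi ih => rw [Finset.sum_insert hi]; exact ((hF i).smul (hc i)).add ih

lemma contMDiffOn_fieldDeriv [Nonempty ι] (hU : IsOpen U) (hX : SmoothFieldOn X U)
    (hf : ContMDiffOn 𝓘(ℝ, E) 𝓘(ℝ, ℝ) ∞ f U) :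
    ContMDiffOn 𝓘(ℝ, E) 𝓘(ℝ, ℝ) ∞ (fieldDeriv X f) U := by
  let i : ι := Classical.arbitrary ι
  refine g.contMDiffOn_fieldDeriv (c := σ i) hU (fun h ↦ ?_) hX (hF.smooth i) (fun x hx ↦ ?_) hf
  · simpa [h] using hF.sign_mul_self i
  · simp [hF.inner x hx]

/-- The `i`-th frame coefficient of `∇_X Y` is `σ i / 2` times the Koszul expression for `F i`, each
term of which is smooth. -/
lemma smoothConnectionOn [Nonempty ι] (hU : IsOpen U) : g.SmoothConnectionOn U := by
  intro X Y hX hY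
  have hK (i : ι) : ContMDiffOn 𝓘(ℝ, E) 𝓘(ℝ, ℝ) ∞
      (fun x ↦ σ i * (g.koszul X Y (F i) x * 2⁻¹)) U := by
    have hi := hF.smooth i
    refine contMDiffOn_const.mul (ContMDiffOn.mul ?_ contMDiffOn_const)
    exact (((((hF.contMDiffOn_fieldDeriv hU hX (g.contMDiffOn_inner hY hi)).add
      (hF.contMDiffOn_fieldDeriv hU hY (g.contMDiffOn_inner hX hi))).sub
      (hF.contMDiffOn_fieldDeriv hU hi (g.contMDiffOn_inner hX hY))).add
      (g.contMDiffOn_inner (hX.bracket hY hU) hi)).sub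
      (g.contMDiffOn_inner (hX.bracket hi hU) hY)).sub
      (g.contMDiffOn_inner (hY.bracket hi hU) hX)
  refine (smoothFieldOn_sum hF.smooth hK Finset.univ).congr fun x hx ↦ ?_
  rw [hF.eq_sum hx (g.leviCivita X Y x), Finset.sum_apply]
  refine Finset.sum_congr rfl fun i _ ↦ ?_
  rw [Pi.smul_apply', ← g.leviCivita_spec (hX.smoothFieldAt hU hx) (hY.smoothFieldAt hU hx)
    ((hF.smooth i).smoothFieldAt hU hx)]
  congr 1
  ring

lemma lieConnection_sum_left [Nonempty ι] (hU : IsOpen U) (hp : p ∈ U) (hV : SmoothFieldOn V U)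
    (hY : SmoothFieldOn Y U) {c : ι → M → ℝ}
    (hc : ∀ i, ContMDiffOn 𝓘(ℝ, E) 𝓘(ℝ, ℝ) ∞ (c i) U) (s : Finset ι) :
    g.lieConnection V (∑ i ∈ s, c i • F i) Y p = ∑ i ∈ s, c i p • g.lieConnection V (F i) Y p := by
  have hg := hF.smoothConnectionOn hU
  have h0 : SmoothFieldOn (0 : ∀ x : M, TangentSpace 𝓘(ℝ, E) x) U := by
    simpa using smoothFieldOn_sum hF.smooth hc ∅
  induction s using Finset.induction_on with
  -- Additivity at `0 + 0` forces the value at the zero field to be zero.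
  | empty => simpa using hg.lieConnection_add_left hU hp hV h0 h0 hY
  | insert i s hi ih =>
    rw [Finset.sum_insert hi, Finset.sum_insert hi,
      hg.lieConnection_add_left hU hp hV ((hF.smooth i).smul (hc i))
        (smoothFieldOn_sum hF.smooth hc s) hY,
      hg.lieConnection_smul_left hU hp hV (hc i) (hF.contMDiffOn_fieldDeriv hU hV (hc i))
        (hF.smooth i) hY, ih]

lemma lieConnection_eq_sum [Nonempty ι] (hU : IsOpen U) (hp : p ∈ U) (hV : SmoothFieldOn V U)
    (hX : SmoothFieldOn X U) (hY : SmoothFieldOn Y U) :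
    g.lieConnection V X Y p
      = ∑ i, (hF.basis hp).repr (X p) i • g.lieConnection V (F i) Y p := by
  have hc (i : ι) : ContMDiffOn 𝓘(ℝ, E) 𝓘(ℝ, ℝ) ∞ (fun x ↦ σ i * g.inner x (X x) (F i x)) U :=
    contMDiffOn_const.mul (g.contMDiffOn_inner hX (hF.smooth i))
  rw [g.lieConnection_congr (X' := ∑ i, (fun x ↦ σ i * g.inner x (X x) (F i x)) • F i) (Y' := Y)
    hU hp (fun x hx ↦ ?_) (fun _ _ ↦ rfl), hF.lieConnection_sum_left hU hp hV hY hc]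
  · simp only [basis_repr]
  · rw [Finset.sum_apply]
    exact hF.eq_sum hx (X x)

/-- Tensoriality frees the value from the chosen extensions. These are smooth only near `p`, hence
the intersection of neighbourhoods; symmetry turns the expansion in the first argument into one in
the second. -/
lemma lieConnectionAt_eq_sum [Nonempty ι] (hU : IsOpen U) (hp : p ∈ U) (hV : SmoothFieldOn V U)
    (v w : TangentSpace 𝓘(ℝ, E) p) :
    g.lieConnectionAt V p v w = ∑ i, ∑ j, ((hF.basis hp).repr v i * (hF.basis hp).repr w j) •
      g.lieConnection V (F i) (F j) p := by
  obtain ⟨U₁, hU₁, hp₁, hv⟩ := exists_smoothFieldOn_extend v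
  obtain ⟨U₂, hU₂, hp₂, hw⟩ := exists_smoothFieldOn_extend w
  have hO : IsOpen (U ∩ (U₁ ∩ U₂)) := hU.inter (hU₁.inter hU₂)
  have hpO : p ∈ U ∩ (U₁ ∩ U₂) := ⟨hp, hp₁, hp₂⟩
  have hF' := hF.mono (inter_subset_left (s := U) (t := U₁ ∩ U₂))
  have hv' := hv.mono (inter_subset_right.trans inter_subset_left : U ∩ (U₁ ∩ U₂) ⊆ U₁)
  have hw' := hw.mono (inter_subset_right.trans inter_subset_right : U ∩ (U₁ ∩ U₂) ⊆ U₂)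
  have hV' := hV.mono (inter_subset_left (s := U) (t := U₁ ∩ U₂))
  have hg := hF'.smoothConnectionOn hO
  rw [lieConnectionAt, hF'.lieConnection_eq_sum hO hpO hV' hv' hw']
  refine Finset.sum_congr rfl fun i _ ↦ ?_
  rw [hg.lieConnection_symm hO hpO hV' (hF'.smooth i) hw',
    hF'.lieConnection_eq_sum hO hpO hV' hw' (hF'.smooth i), Finset.smul_sum]
  refine Finset.sum_congr rfl fun j _ ↦ ?_
  rw [hg.lieConnection_symm hO hpO hV' (hF'.smooth j) (hF'.smooth i), smul_smul]
  simp only [basis_repr, FiberBundle.extend_apply_self]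

lemma gram_eq (hp : p ∈ U) {κ : Type*} (b : κ → TangentSpace 𝓘(ℝ, E) p) :
    g.gram p b = ((hF.basis hp).toMatrix b).transpose * Matrix.diagonal σ
      * (hF.basis hp).toMatrix b := by
  ext k l
  have h := congrArg (fun v ↦ g.inner p (b k) v) ((hF.basis hp).sum_repr (b l))
  simp only [map_sum, map_smul, smul_eq_mul, basis_apply] at h
  rw [gram, Matrix.of_apply, Matrix.mul_apply]
  simp only [Matrix.mul_diagonal, Matrix.transpose_apply, Module.Basis.toMatrix_apply]
  rw [← h]
  refine Finset.sum_congr rfl fun i _ ↦ ?_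
  rw [hF.basis_repr hp (b k)]
  -- The coefficient of `b k` contains `σ i` and the diagonal matrix contributes another; they
  -- cancel.
  linear_combination (-(hF.basis hp).repr (b l) i * g.inner p (b k) (F i p)) * hF.sign_mul_self i

/-- The metric trace of `L_V ∇` computed in a pseudo-orthonormal frame. -/
theorem traceLieConnection_eq [Nonempty ι] (hU : IsOpen U) (hp : p ∈ U) (hV : SmoothFieldOn V U) :
    g.traceLieConnection V p = ∑ i, σ i • g.lieConnection V (F i) (F i) p := by
  simp only [traceLieConnection]
  set b : Module.Basis (Fin (Module.finrank ℝ E)) ℝ (TangentSpace 𝓘(ℝ, E) p) :=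
    Module.finBasis ℝ E
  set T := (hF.basis hp).toMatrix b
  set T' := b.toMatrix (hF.basis hp)
  have hT : T * T' = 1 := (hF.basis hp).toMatrix_mul_toMatrix_flip b
  have hT' : T' * T = 1 := b.toMatrix_mul_toMatrix_flip (hF.basis hp)
  have hσ : Matrix.diagonal σ * Matrix.diagonal σ = 1 := by
    rw [Matrix.diagonal_mul_diagonal, ← Matrix.diagonal_one]
    exact congrArg _ (funext hF.sign_mul_self)
  have hTt : T.transpose * T'.transpose = 1 := by
    rw [← Matrix.transpose_mul, hT', Matrix.transpose_one]
  have hTt' : T'.transpose * T.transpose = 1 := by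
    rw [← Matrix.transpose_mul, hT, Matrix.transpose_one]
  have hinv : (g.gram p b)⁻¹ = T' * Matrix.diagonal σ * T'.transpose := by
    refine Matrix.inv_eq_right_inv ?_
    rw [hF.gram_eq hp]
    calc T.transpose * Matrix.diagonal σ * T * (T' * Matrix.diagonal σ * T'.transpose)
        = T.transpose * (Matrix.diagonal σ * (T * T') * Matrix.diagonal σ) * T'.transpose := by
          simp only [Matrix.mul_assoc]
      _ = 1 := by rw [hT, Matrix.mul_one, hσ, Matrix.mul_one, hTt]
  -- Basis independence of the trace: the inverse Gram matrix transforms contravariantly, so in the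
  -- frame it becomes the diagonal matrix of signs.
  have hsum : T * (g.gram p b)⁻¹ * T.transpose = Matrix.diagonal σ := by
    rw [hinv]
    calc T * (T' * Matrix.diagonal σ * T'.transpose) * T.transpose
        = (T * T') * Matrix.diagonal σ * (T'.transpose * T.transpose) := by
          simp only [Matrix.mul_assoc]
      _ = Matrix.diagonal σ := by rw [hT, hTt', Matrix.one_mul, Matrix.mul_one]
  calc ∑ i, ∑ j, (g.gram p b)⁻¹ i j • g.lieConnectionAt V p (b i) (b j)
      = ∑ k, ∑ l, (T * (g.gram p b)⁻¹ * T.transpose) k l • g.lieConnection V (F k) (F l) p := by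
        simp only [hF.lieConnectionAt_eq_sum hU hp hV, Finset.smul_sum, Matrix.mul_apply,
          Finset.sum_smul, Matrix.transpose_apply, Finset.sum_mul]
        rw [Finset.sum_congr rfl fun i _ ↦ Finset.sum_comm, Finset.sum_comm]
        refine Finset.sum_congr rfl fun k _ ↦ ?_
        rw [Finset.sum_congr rfl fun i _ ↦ Finset.sum_comm, Finset.sum_comm]
        refine Finset.sum_congr rfl fun l _ ↦ ?_
        rw [Finset.sum_comm]
        refine Finset.sum_congr rfl fun j _ ↦ Finset.sum_congr rfl fun i _ ↦ ?_
        simp only [T, Module.Basis.toMatrix_apply, smul_smul]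
        congr 1
        ring
    _ = _ := by
        rw [hsum]
        simp [Matrix.diagonal_apply, ite_smul]

end IsOrthonormalFrameOn

end Frame

end PseudoRiemannianMetric

/-! ### Frames with the brackets of a φ-basis, and the trace of L_ξ ∇ -/

namespace PseudoRiemannianMetric

section ReebFrame

set_option linter.unusedSectionVars false

variable {E : Type*} [NormedAddCommGroup E] [NormedSpace ℝ E] [FiniteDimensional ℝ E]
  {M : Type*} [TopologicalSpace M] [ChartedSpace E M] [IsManifold 𝓘(ℝ, E) ∞ M]
  {g : PseudoRiemannianMetric E M}
  {V X Y Z W ξ e f : ∀ x : M, TangentSpace 𝓘(ℝ, E) x} {U : Set M} {p : M}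
  {a b c A B C D α β : M → ℝ}

lemma fieldDeriv_neg : fieldDeriv X (fun x ↦ -a x) p = -fieldDeriv X a p := by
  simp [fieldDeriv, mvfderiv_fun_neg]

lemma fieldBracket_combination_right (hU : IsOpen U) (hp : p ∈ U)
    (hX : SmoothFieldOn X U) (hY : SmoothFieldOn Y U)
    (ha : ContMDiffOn 𝓘(ℝ, E) 𝓘(ℝ, ℝ) ∞ a U) (hb : ContMDiffOn 𝓘(ℝ, E) 𝓘(ℝ, ℝ) ∞ b U)
    (hW : ∀ x ∈ U, W x = a x • X x + b x • Y x) :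
    fieldBracket V W p = fieldDeriv V a p • X p + a p • fieldBracket V X p
      + (fieldDeriv V b p • Y p + b p • fieldBracket V Y p) := by
  rw [fieldBracket_congr (X := V) (Y := W) (W := a • X + b • Y) hU hp (fun _ _ ↦ rfl) hW,
    fieldBracket_add_right ((hX.smul ha).mdifferentiableAt_section hU hp)
      ((hY.smul hb).mdifferentiableAt_section hU hp),
    fieldBracket_smul_right (ha.mdifferentiableAt_of_isOpen hU hp)
      (hX.mdifferentiableAt_section hU hp),
    fieldBracket_smul_right (hb.mdifferentiableAt_of_isOpen hU hp)
      (hY.mdifferentiableAt_section hU hp)]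

variable (g) in
lemma leviCivita_combination_left (hU : IsOpen U) (hp : p ∈ U)
    (hX : SmoothFieldOn X U) (hY : SmoothFieldOn Y U) (hV : SmoothFieldOn V U)
    (ha : ContMDiffOn 𝓘(ℝ, E) 𝓘(ℝ, ℝ) ∞ a U) (hb : ContMDiffOn 𝓘(ℝ, E) 𝓘(ℝ, ℝ) ∞ b U)
    (hW : ∀ x ∈ U, W x = a x • X x + b x • Y x) :
    g.leviCivita W V p = a p • g.leviCivita X V p + b p • g.leviCivita Y V p := by
  rw [g.leviCivita_congr (X := W) (V := a • X + b • Y) (Y := V) hU hp hW (fun _ _ ↦ rfl),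
    g.leviCivita_add_left hU hp (hX.smul ha) (hY.smul hb) hV,
    g.leviCivita_smul_left hU hp ha hX hV, g.leviCivita_smul_left hU hp hb hY hV]

variable (g) in
lemma leviCivita_combination_right (hU : IsOpen U) (hp : p ∈ U)
    (hX : SmoothFieldOn X U) (hY : SmoothFieldOn Y U) (hV : SmoothFieldOn V U)
    (ha : ContMDiffOn 𝓘(ℝ, E) 𝓘(ℝ, ℝ) ∞ a U) (hb : ContMDiffOn 𝓘(ℝ, E) 𝓘(ℝ, ℝ) ∞ b U)
    (hW : ∀ x ∈ U, W x = a x • X x + b x • Y x) :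
    g.leviCivita V W p = fieldDeriv V a p • X p + a p • g.leviCivita V X p
      + (fieldDeriv V b p • Y p + b p • g.leviCivita V Y p) := by
  rw [g.leviCivita_congr (X := V) (Y := W) (W := a • X + b • Y) hU hp (fun _ _ ↦ rfl) hW,
    g.leviCivita_add_right hU hp (hX.smul ha) (hY.smul hb) hV,
    g.leviCivita_smul_right hU hp ha hX hV, g.leviCivita_smul_right hU hp hb hY hV]

namespace IsOrthonormalFrameOn

/-- The Koszul formula in a pseudo-orthonormal frame. -/
lemma two_mul_inner_leviCivita {ι : Type*} [Fintype ι] [DecidableEq ι]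
    {F : ι → ∀ x : M, TangentSpace 𝓘(ℝ, E) x} {σ : ι → ℝ} (hF : g.IsOrthonormalFrameOn F σ U)
    (hU : IsOpen U) (hp : p ∈ U) (i j k : ι) {X Y Z : ∀ x : M, TangentSpace 𝓘(ℝ, E) x}
    (hX : X = F i) (hY : Y = F j) (hZ : Z = F k) :
    2 * g.inner p (g.leviCivita X Y p) (Z p)
      = g.inner p (fieldBracket X Y p) (Z p) - g.inner p (fieldBracket X Z p) (Y p)
        - g.inner p (fieldBracket Y Z p) (X p) := by
  subst hX hY hZ
  rw [g.leviCivita_spec ((hF.smooth i).smoothFieldAt hU hp) ((hF.smooth j).smoothFieldAt hU hp)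
    ((hF.smooth k).smoothFieldAt hU hp), koszul,
    fieldDeriv_eq_zero_of_eqOn_const hU hp (fun x hx ↦ hF.inner x hx j k),
    fieldDeriv_eq_zero_of_eqOn_const hU hp (fun x hx ↦ hF.inner x hx i k),
    fieldDeriv_eq_zero_of_eqOn_const hU hp (fun x hx ↦ hF.inner x hx i j)]
  ring

variable (hF : g.IsOrthonormalFrameOn ![ξ, e, f] ![1, 1, -1] U)
include hF

lemma coeff_eq (hp : p ∈ U) {a b c a' b' c' : ℝ}
    (h : a • ξ p + b • e p + c • f p = a' • ξ p + b' • e p + c' • f p) :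
    a = a' ∧ b = b' ∧ c = c' := by
  have h' := (hF.linearIndependent hp)
  rw [Fintype.linearIndependent_iff] at h'
  have := h' ![a - a', b - b', c - c'] (by
    rw [Fin.sum_univ_three]
    change (a - a') • ξ p + (b - b') • e p + (c - c') • f p = 0
    rw [← sub_eq_zero] at h
    rw [← h]
    module)
  refine ⟨sub_eq_zero.1 (this 0), sub_eq_zero.1 (this 1), sub_eq_zero.1 (this 2)⟩

/-- The Jacobi identity for a frame whose first field preserves the span of the other two. -/
lemma jacobi (hU : IsOpen U) (hp : p ∈ U)
    (hA : ContMDiffOn 𝓘(ℝ, E) 𝓘(ℝ, ℝ) ∞ A U) (hB : ContMDiffOn 𝓘(ℝ, E) 𝓘(ℝ, ℝ) ∞ B U)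
    (hC : ContMDiffOn 𝓘(ℝ, E) 𝓘(ℝ, ℝ) ∞ C U) (hD : ContMDiffOn 𝓘(ℝ, E) 𝓘(ℝ, ℝ) ∞ D U)
    (hα : ContMDiffOn 𝓘(ℝ, E) 𝓘(ℝ, ℝ) ∞ α U) (hβ : ContMDiffOn 𝓘(ℝ, E) 𝓘(ℝ, ℝ) ∞ β U)
    (hξe : ∀ x ∈ U, fieldBracket ξ e x = A x • e x + B x • f x)
    (hξf : ∀ x ∈ U, fieldBracket ξ f x = C x • e x + D x • f x)
    (hef : ∀ x ∈ U, fieldBracket e f x = (-2 : ℝ) • ξ x + α x • e x + β x • f x) :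
    D p = -A p ∧
      fieldDeriv ξ α p + α p * A p + β p * C p = -fieldDeriv f A p + fieldDeriv e C p
        + (A p + D p) * α p ∧
      α p * B p + fieldDeriv ξ β p + β p * D p = -fieldDeriv f B p + fieldDeriv e D p
        + (A p + D p) * β p := by
  have sξ : SmoothFieldOn ξ U := hF.smooth 0
  have se : SmoothFieldOn e U := hF.smooth 1
  have sf : SmoothFieldOn f U := hF.smooth 2
  have hJ := fieldBracket_jacobi (sξ.smoothFieldAt hU hp) (se.smoothFieldAt hU hp)
    (sf.smoothFieldAt hU hp)
  -- The two-term Leibniz rule is applied to `[e, f]` as `-2` times `ξ` plus `1` times `α e + β f`,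
  -- and then to the latter field.
  have h1 : ContMDiffOn 𝓘(ℝ, E) 𝓘(ℝ, ℝ) ∞ (fun _ : M ↦ (1 : ℝ)) U := contMDiffOn_const
  have h2 : ContMDiffOn 𝓘(ℝ, E) 𝓘(ℝ, ℝ) ∞ (fun _ : M ↦ (-2 : ℝ)) U := contMDiffOn_const
  have hW : SmoothFieldOn (α • e + β • f) U := (se.smul hα).add (sf.smul hβ)
  rw [fieldBracket_combination_right (V := ξ) (W := fieldBracket e f) (Y := α • e + β • f)
      hU hp sξ hW h2 h1 (fun x hx ↦ by rw [hef x hx]; simp [add_assoc]),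
    fieldBracket_combination_right (V := ξ) (W := α • e + β • f) hU hp se sf hα hβ
      (fun x hx ↦ rfl),
    fieldBracket_combination_right (V := e) (W := fieldBracket ξ f) hU hp se sf hC hD hξf,
    fieldBracket_swap (X := fieldBracket ξ e) (Y := f),
    fieldBracket_combination_right (V := f) (W := fieldBracket ξ e) hU hp se sf hA hB hξe,
    fieldBracket_swap (X := f) (Y := e), hξe p hp, hξf p hp, hef p hp] at hJ
  simp only [fieldBracket, VectorField.mlieBracket_self, Pi.zero_apply] at hJ
  simp only [fieldDeriv_const, Pi.add_apply] at hJ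
  -- The `ξ`-component is zero on the left, while on the right the term `(A + D) [e, f]` contributes
  -- `-2 (A + D)`.
  obtain ⟨h1, h2, h3⟩ := hF.coeff_eq hp
    (a := 0) (b := fieldDeriv ξ α p + α p * A p + β p * C p)
    (c := α p * B p + fieldDeriv ξ β p + β p * D p)
    (a' := -2 * A p + -2 * D p)
    (b' := -fieldDeriv f A p + fieldDeriv e C p + (A p + D p) * α p)
    (c' := -fieldDeriv f B p + fieldDeriv e D p + (A p + D p) * β p) (by
      rw [← sub_eq_zero] at hJ ⊢
      rw [← hJ]
      module)
  exact ⟨by linarith, h2, h3⟩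

end IsOrthonormalFrameOn

variable (g) in
/-- A pseudo-orthonormal frame `ξ, e, f` on `U`, with `f` time-like, whose brackets are those of
a `φ`-basis `{ξ, e, φ e}`. -/
structure IsReebFrameOn (ξ e f : ∀ x : M, TangentSpace 𝓘(ℝ, E) x) (A B C α β : M → ℝ)
    (U : Set M) : Prop where
  isOpen : IsOpen U
  frame : g.IsOrthonormalFrameOn ![ξ, e, f] ![1, 1, -1] U
  smooth_A : ContMDiffOn 𝓘(ℝ, E) 𝓘(ℝ, ℝ) ∞ A U
  smooth_B : ContMDiffOn 𝓘(ℝ, E) 𝓘(ℝ, ℝ) ∞ B U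
  smooth_C : ContMDiffOn 𝓘(ℝ, E) 𝓘(ℝ, ℝ) ∞ C U
  smooth_α : ContMDiffOn 𝓘(ℝ, E) 𝓘(ℝ, ℝ) ∞ α U
  smooth_β : ContMDiffOn 𝓘(ℝ, E) 𝓘(ℝ, ℝ) ∞ β U
  bracket_ξe : ∀ x ∈ U, fieldBracket ξ e x = A x • e x + B x • f x
  bracket_ξf : ∀ x ∈ U, fieldBracket ξ f x = C x • e x + (-A x) • f x
  bracket_ef : ∀ x ∈ U, fieldBracket e f x = (-2 : ℝ) • ξ x + α x • e x + β x • f x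

namespace IsReebFrameOn

variable (h : g.IsReebFrameOn ξ e f A B C α β U)
include h

lemma smooth_ξ : SmoothFieldOn ξ U := h.frame.smooth 0
lemma smooth_e : SmoothFieldOn e U := h.frame.smooth 1
lemma smooth_f : SmoothFieldOn f U := h.frame.smooth 2

lemma jacobi (hp : p ∈ U) :
    fieldDeriv ξ α p + α p * A p + β p * C p = -fieldDeriv f A p + fieldDeriv e C p ∧
      α p * B p + fieldDeriv ξ β p - β p * A p = -fieldDeriv f B p - fieldDeriv e A p := by
  obtain ⟨-, h2, h3⟩ := h.frame.jacobi h.isOpen hp h.smooth_A h.smooth_B h.smooth_C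
    h.smooth_A.neg h.smooth_α h.smooth_β h.bracket_ξe h.bracket_ξf h.bracket_ef
  rw [fieldDeriv_neg] at h3
  constructor <;> linarith

lemma inner_frame (hp : p ∈ U) :
    g.inner p (ξ p) (ξ p) = 1 ∧ g.inner p (ξ p) (e p) = 0 ∧ g.inner p (ξ p) (f p) = 0 ∧
    g.inner p (e p) (ξ p) = 0 ∧ g.inner p (e p) (e p) = 1 ∧ g.inner p (e p) (f p) = 0 ∧
    g.inner p (f p) (ξ p) = 0 ∧ g.inner p (f p) (e p) = 0 ∧ g.inner p (f p) (f p) = -1 :=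
  ⟨h.frame.inner p hp 0 0, h.frame.inner p hp 0 1, h.frame.inner p hp 0 2,
    h.frame.inner p hp 1 0, h.frame.inner p hp 1 1, h.frame.inner p hp 1 2,
    h.frame.inner p hp 2 0, h.frame.inner p hp 2 1, h.frame.inner p hp 2 2⟩

/-- The factors `2` match the Koszul formula; the sign in the last hypothesis comes from `g(f, f) =
-1`. -/
lemma eq_of_inner (hp : p ∈ U) {v : TangentSpace 𝓘(ℝ, E) p} {a b c : ℝ}
    (h0 : 2 * g.inner p v (ξ p) = 2 * a) (h1 : 2 * g.inner p v (e p) = 2 * b)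
    (h2 : 2 * g.inner p v (f p) = -2 * c) : v = a • ξ p + b • e p + c • f p := by
  obtain ⟨k1, k2, k3, k4, k5, k6, k7, k8, k9⟩ := h.inner_frame hp
  refine h.frame.ext_inner_frame hp fun i ↦ ?_
  fin_cases i
  · change g.inner p v (ξ p) = g.inner p (a • ξ p + b • e p + c • f p) (ξ p)
    simp only [map_add, map_smul, add_apply, smul_apply, smul_eq_mul, k1, k4, k7]
    linarith
  · change g.inner p v (e p) = g.inner p (a • ξ p + b • e p + c • f p) (e p)
    simp only [map_add, map_smul, add_apply, smul_apply, smul_eq_mul, k2, k5, k8]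
    linarith
  · change g.inner p v (f p) = g.inner p (a • ξ p + b • e p + c • f p) (f p)
    simp only [map_add, map_smul, add_apply, smul_apply, smul_eq_mul, k3, k6, k9]
    linarith

/-- Because `[ξ, e]` and `[ξ, f]` lie in the span of `e, f`, this is the only derivative along `ξ`
that the trace requires. -/
lemma leviCivita_ξξ (hp : p ∈ U) : g.leviCivita ξ ξ p = 0 := by
  obtain ⟨k1, k2, k3, k4, k5, k6, k7, k8, k9⟩ := h.inner_frame hp
  have K := h.frame.two_mul_inner_leviCivita h.isOpen hp
  have := h.eq_of_inner hp (v := g.leviCivita ξ ξ p) (a := 0) (b := 0) (c := 0)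
    (.trans (K 0 0 0 rfl rfl rfl) ?_) (.trans (K 0 0 1 rfl rfl rfl) ?_)
    (.trans (K 0 0 2 rfl rfl rfl) ?_)
  · simpa using this
  all_goals simp [h.bracket_ξe p hp, h.bracket_ξf p hp, k4, k7]

lemma leviCivita_ee (hp : p ∈ U) : g.leviCivita e e p = A p • ξ p + α p • f p := by
  obtain ⟨k1, k2, k3, k4, k5, k6, k7, k8, k9⟩ := h.inner_frame hp
  have K := h.frame.two_mul_inner_leviCivita h.isOpen hp
  have := h.eq_of_inner hp (v := g.leviCivita e e p) (a := A p) (b := 0) (c := α p)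
    (.trans (K 1 1 0 rfl rfl rfl) ?_) (.trans (K 1 1 1 rfl rfl rfl) ?_)
    (.trans (K 1 1 2 rfl rfl rfl) ?_)
  · simpa using this
  all_goals simp [fieldBracket_swap (X := e) (Y := ξ), h.bracket_ξe p hp, h.bracket_ef p hp,
    k2, k5, k8]
  all_goals ring

lemma leviCivita_ff (hp : p ∈ U) : g.leviCivita f f p = A p • ξ p + (-β p) • e p := by
  obtain ⟨k1, k2, k3, k4, k5, k6, k7, k8, k9⟩ := h.inner_frame hp
  have K := h.frame.two_mul_inner_leviCivita h.isOpen hp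
  have := h.eq_of_inner hp (v := g.leviCivita f f p) (a := A p) (b := -β p) (c := 0)
    (.trans (K 2 2 0 rfl rfl rfl) ?_) (.trans (K 2 2 1 rfl rfl rfl) ?_)
    (.trans (K 2 2 2 rfl rfl rfl) ?_)
  · simpa using this
  all_goals simp [fieldBracket_swap (X := f) (Y := ξ), fieldBracket_swap (X := f) (Y := e),
    h.bracket_ξf p hp, h.bracket_ef p hp, k3, k6, k9]
  all_goals ring

lemma leviCivita_ef (hp : p ∈ U) :
    g.leviCivita e f p = (-1 + (C p - B p) / 2) • ξ p + α p • e p := by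
  obtain ⟨k1, k2, k3, k4, k5, k6, k7, k8, k9⟩ := h.inner_frame hp
  have K := h.frame.two_mul_inner_leviCivita h.isOpen hp
  have := h.eq_of_inner hp (v := g.leviCivita e f p) (a := -1 + (C p - B p) / 2) (b := α p)
    (c := 0) (.trans (K 1 2 0 rfl rfl rfl) ?_) (.trans (K 1 2 1 rfl rfl rfl) ?_)
    (.trans (K 1 2 2 rfl rfl rfl) ?_)
  · simpa using this
  all_goals simp [fieldBracket_swap (X := f) (Y := ξ), fieldBracket_swap (X := f) (Y := e),
    fieldBracket_swap (X := e) (Y := ξ), h.bracket_ξe p hp, h.bracket_ξf p hp,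
    h.bracket_ef p hp, k1, k2, k3, k4, k5, k6, k7, k8, k9]
  all_goals ring

lemma leviCivita_fe (hp : p ∈ U) :
    g.leviCivita f e p = (1 + (C p - B p) / 2) • ξ p + (-β p) • f p := by
  have := g.leviCivita_torsion (h.smooth_e.smoothFieldAt h.isOpen hp)
    (h.smooth_f.smoothFieldAt h.isOpen hp)
  rw [h.leviCivita_ef hp, h.bracket_ef p hp, ← sub_eq_iff_eq_add] at this
  rw [← this]
  module

/-- The metric trace of `L_ξ ∇` in a Reeb frame. -/
theorem traceLieConnection_eq (hp : p ∈ U) :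
    g.traceLieConnection ξ p
      = ((C p - B p) ^ 2 - 4 * A p ^ 2) • ξ p
        + (2 * α p * (C p - B p) + 4 * A p * β p - 2 * fieldDeriv e A p
            + fieldDeriv f C p - fieldDeriv f B p) • e p
        + (-4 * α p * A p - 2 * β p * (C p - B p) + fieldDeriv e C p - fieldDeriv e B p
            - 2 * fieldDeriv f A p) • f p := by
  have hU := h.isOpen
  have sξ := h.smooth_ξ
  have se := h.smooth_e
  have sf := h.smooth_f
  have h0 : SmoothFieldOn (0 : ∀ x : M, TangentSpace 𝓘(ℝ, E) x) U :=
    contMDiffOn_zeroSection ℝ (TangentSpace 𝓘(ℝ, E) : M → Type _)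
  have z1 : g.leviCivita (0 : ∀ x : M, TangentSpace 𝓘(ℝ, E) x) ξ p = 0 := by
    simpa using g.leviCivita_add_left hU hp h0 h0 sξ
  have z2 : g.leviCivita ξ (0 : ∀ x : M, TangentSpace 𝓘(ℝ, E) x) p = 0 := by
    simpa using g.leviCivita_add_right hU hp h0 h0 sξ
  obtain ⟨J1, J2⟩ := h.jacobi hp
  rw [h.frame.traceLieConnection_eq hU hp sξ]
  rw [Fin.sum_univ_three]
  change (1 : ℝ) • g.lieConnection ξ ξ ξ p + (1 : ℝ) • g.lieConnection ξ e e p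
    + (-1 : ℝ) • g.lieConnection ξ f f p = _
  simp only [lieConnection]
  have nA := h.smooth_A.neg
  rw [fieldBracket_congr (Y := g.leviCivita ξ ξ) (W := 0) hU hp (fun _ _ ↦ rfl)
      (fun x hx ↦ h.leviCivita_ξξ hx),
    show fieldBracket ξ ξ = 0 from VectorField.mlieBracket_self,
    show fieldBracket ξ 0 = 0 from VectorField.mlieBracket_zero_right, z1, z2,
    fieldBracket_combination_right hU hp sξ sf h.smooth_A h.smooth_α
      (fun x hx ↦ h.leviCivita_ee hx),
    fieldBracket_combination_right hU hp sξ se h.smooth_A h.smooth_β.neg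
      (fun x hx ↦ h.leviCivita_ff hx),
    g.leviCivita_combination_left hU hp se sf se h.smooth_A h.smooth_B h.bracket_ξe,
    g.leviCivita_combination_right hU hp se sf se h.smooth_A h.smooth_B h.bracket_ξe,
    g.leviCivita_combination_left hU hp se sf sf h.smooth_C nA h.bracket_ξf,
    g.leviCivita_combination_right hU hp se sf sf h.smooth_C nA h.bracket_ξf,
    h.leviCivita_ee hp, h.leviCivita_ff hp, h.leviCivita_ef hp, h.leviCivita_fe hp,
    h.bracket_ξe p hp, h.bracket_ξf p hp]
  simp only [fieldDeriv_neg, Pi.zero_apply, VectorField.mlieBracket_self, fieldBracket]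
  -- The terms `ξ(A)` cancel, since `∇_e e` and `∇_f f` have the same `ξ`-component and enter with
  -- opposite signs. Jacobi removes the remaining derivatives along `ξ`.
  have e1 : fieldDeriv ξ α p = -fieldDeriv f A p + fieldDeriv e C p - α p * A p - β p * C p := by
    linarith
  have e2 : fieldDeriv ξ β p = -fieldDeriv f B p - fieldDeriv e A p - α p * B p + β p * A p := by
    linarith
  rw [e1, e2]
  module

end IsReebFrameOn

end ReebFrame

end PseudoRiemannianMetric

/-! ### Existence of φ-bases and their brackets -/

namespace ParacontactMetricStructure

section PhiBasis

set_option linter.unusedSectionVars false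

variable {E : Type*} [NormedAddCommGroup E] [NormedSpace ℝ E]
  {M : Type*} [TopologicalSpace M] [ChartedSpace E M] [IsManifold 𝓘(ℝ, E) ∞ M]
  (S : ParacontactMetricStructure E M)
  {X Y e : ∀ x : M, TangentSpace 𝓘(ℝ, E) x} {U : Set M} {p : M}

lemma inner_ξ_left (v : TangentSpace 𝓘(ℝ, E) p) : S.g.inner p (S.ξ p) v = S.η p v := by
  have h := S.compatible p (S.ξ p) v
  rw [S.φ_ξ, S.η_ξ] at h
  simp only [map_zero, zero_apply] at h
  linarith

lemma inner_φ_left (v w : TangentSpace 𝓘(ℝ, E) p) :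
    S.g.inner p (S.φ p v) w = -S.g.inner p v (S.φ p w) := by
  have h := S.compatible p v (S.φ p w)
  rw [S.φ_φ, S.η_φ, map_sub, map_smul, S.g.symm p _ (S.ξ p), S.inner_ξ_left, S.η_φ] at h
  simp only [smul_eq_mul, mul_zero, sub_zero, add_zero] at h
  linarith

lemma inner_φ_self (v : TangentSpace 𝓘(ℝ, E) p) : S.g.inner p v (S.φ p v) = 0 := by
  have h := S.inner_φ_left v v
  rw [S.g.symm] at h
  linarith

lemma isPhiBasisOn (hs : SmoothFieldOn e U) (hη : ∀ x ∈ U, S.η x (e x) = 0)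
    (hee : ∀ x ∈ U, S.g.inner x (e x) (e x) = 1) : S.IsPhiBasisOn e U where
  smooth := hs
  ξ_ξ x _ := by rw [S.inner_ξ_left, S.η_ξ]
  e_e := hee
  φe_φe x hx := by rw [S.compatible, hee x hx, hη x hx]; simp
  ξ_e x hx := by rw [S.inner_ξ_left, hη x hx]
  ξ_φe x _ := by rw [S.inner_ξ_left, S.η_φ]
  e_φe x _ := S.inner_φ_self _

lemma η_sub_η_smul_ξ (v : TangentSpace 𝓘(ℝ, E) p) : S.η p (v - S.η p v • S.ξ p) = 0 := by
  simp [S.η_ξ]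

/-- The contact distribution contains a space-like vector. -/
lemma exists_spacelike (h1 : 1 < Module.finrank ℝ E) (p : M) :
    ∃ v : TangentSpace 𝓘(ℝ, E) p, S.η p v = 0 ∧ 0 < S.g.inner p v v := by
  by_contra! hcon
  -- On `ker η` the map `φ` reverses the sign of `g(v, v)`: without space-like vectors there are no
  -- time-like ones, so all vectors are null.
  have hnull (v : TangentSpace 𝓘(ℝ, E) p) (hv : S.η p v = 0) : S.g.inner p v v = 0 := by
    have h1 := hcon v hv
    have h2 := hcon (S.φ p v) (S.η_φ p v)
    rw [S.compatible, hv] at h2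
    linarith
  -- By polarization `g` vanishes on `ker η`, which is also orthogonal to `ξ`; nondegeneracy then
  -- gives `ker η = 0`.
  have hzero (v : TangentSpace 𝓘(ℝ, E) p) (hv : S.η p v = 0) : v = 0 := by
    refine S.g.nondegenerate p v fun u ↦ ?_
    have hu := S.η_sub_η_smul_ξ u
    set w := u - S.η p u • S.ξ p with hw
    have h3 := hnull (v + w) (by rw [map_add, hv, hu, add_zero])
    simp only [map_add, add_apply, hnull v hv, hnull w hu, S.g.symm p w v] at h3
    have h4 : S.g.inner p v w = 0 := by linarith
    rw [hw, map_sub, map_smul, S.g.symm p v (S.ξ p), S.inner_ξ_left, hv] at h4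
    simpa using h4
  have hle : Module.finrank ℝ (TangentSpace 𝓘(ℝ, E) p) ≤ 1 :=
    finrank_le_one (S.ξ p) fun u ↦
      ⟨S.η p u, (sub_eq_zero.1 (hzero _ (S.η_sub_η_smul_ξ u))).symm⟩
  exact absurd hle (not_le.2 h1)

/-- A space-like vector of `ker η` is extended, projected to `ker η` along `ξ`, and normalized on
the open set where its square length stays positive. -/
lemma exists_isPhiBasisOn (h1 : 1 < Module.finrank ℝ E) (p : M) :
    ∃ (U : Set M) (e : ∀ x : M, TangentSpace 𝓘(ℝ, E) x),
      IsOpen U ∧ p ∈ U ∧ S.IsPhiBasisOn e U := by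
  obtain ⟨v, hv, hpos⟩ := S.exists_spacelike h1 p
  obtain ⟨U, hU, hp, hs⟩ := exists_smoothFieldOn_extend v
  set X := FiberBundle.extend E v
  have hXp : X p = v := FiberBundle.extend_apply_self ..
  let Y : ∀ x : M, TangentSpace 𝓘(ℝ, E) x := fun x ↦ X x - S.η x (X x) • S.ξ x
  have hηX := hs.form_apply S.contMDiff_η
  have hY : SmoothFieldOn Y U :=
    (hs.add ((S.contMDiff_ξ.mono (subset_univ U)).smul hηX.neg)).congr fun x _ ↦ by
      change X x - S.η x (X x) • S.ξ x = X x + (-S.η x (X x)) • S.ξ x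
      module
  have hηY (x : M) : S.η x (Y x) = 0 := S.η_sub_η_smul_ξ (X x)
  have hYp : Y p = v := by simp only [Y, hXp, hv, zero_smul, sub_zero]
  have hN := S.g.contMDiffOn_inner hY hY
  let U' := U ∩ (fun x ↦ S.g.inner x (Y x) (Y x)) ⁻¹' Ioi 0
  have hU' : IsOpen U' := hN.continuousOn.isOpen_inter_preimage hU isOpen_Ioi
  have hc : ContMDiffOn 𝓘(ℝ, E) 𝓘(ℝ, ℝ) ∞ (fun x ↦ (√(S.g.inner x (Y x) (Y x)))⁻¹) U' := by
    intro x hx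
    have h0 : 0 < S.g.inner x (Y x) (Y x) := hx.2
    have h2 : ContDiffAt ℝ ∞ (fun t : ℝ ↦ (√t)⁻¹) (S.g.inner x (Y x) (Y x)) :=
      (Real.contDiffAt_sqrt h0.ne').inv (Real.sqrt_ne_zero'.2 h0)
    exact ContMDiffAt.comp_contMDiffWithinAt (f := fun x ↦ S.g.inner x (Y x) (Y x))
      (g := fun t : ℝ ↦ (√t)⁻¹) x h2.contMDiffAt ((hN x hx.1).mono inter_subset_left)
  refine ⟨U', (fun x ↦ (√(S.g.inner x (Y x) (Y x)))⁻¹) • Y, hU',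
    ⟨hp, by simpa only [mem_preimage, hYp, mem_Ioi] using hpos⟩,
    S.isPhiBasisOn ((hY.mono inter_subset_left).smul hc) (fun x _ ↦ ?_) fun x hx ↦ ?_⟩
  · rw [Pi.smul_apply', map_smul, hηY, smul_zero]
  · have h0 : 0 < S.g.inner x (Y x) (Y x) := hx.2
    simp only [Pi.smul_apply', map_smul, smul_apply, smul_eq_mul]
    have := Real.mul_self_sqrt h0.le
    have hne := Real.sqrt_ne_zero'.2 h0
    field_simp
    rw [sq, this]

/-- For constant `η(X)` and `η(Y)` only the bracket survives in `dη(X, Y)`, so the contact condition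
determines the `ξ`-component of `[X, Y]`. -/
lemma η_fieldBracket (hU : IsOpen U) (hp : p ∈ U) (hX : SmoothFieldOn X U)
    (hY : SmoothFieldOn Y U) {c d : ℝ} (hc : ∀ x ∈ U, S.η x (X x) = c)
    (hd : ∀ x ∈ U, S.η x (Y x) = d) :
    S.η p (fieldBracket X Y p) = -2 * S.g.inner p (X p) (S.φ p (Y p)) := by
  have h := S.extDeriv_η p X Y (hX.smoothFieldAt hU hp) (hY.smoothFieldAt hU hp)
  rw [extDerivForm, fieldDeriv_eq_zero_of_eqOn_const hU hp hd,
    fieldDeriv_eq_zero_of_eqOn_const hU hp hc] at h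
  linarith

namespace IsPhiBasisOn

variable {S} [FiniteDimensional ℝ E] (h : S.IsPhiBasisOn e U) (hU : IsOpen U)
  (hE : Module.finrank ℝ E = 3)
include h

lemma smooth_φ : SmoothFieldOn (fun x ↦ S.φ x (e x)) U := h.smooth.clm_apply S.contMDiff_φ

include hE in
lemma isOrthonormalFrameOn :
    S.g.IsOrthonormalFrameOn ![S.ξ, e, fun x ↦ S.φ x (e x)] ![1, 1, -1] U where
  smooth i := by
    fin_cases i
    exacts [S.contMDiff_ξ.mono (subset_univ U), h.smooth, h.smooth_φ]
  sign_mul_self i := by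
    fin_cases i
    exacts [one_mul (1 : ℝ), one_mul (1 : ℝ), by change (-1 : ℝ) * -1 = 1; norm_num]
  inner x hx i j := by
    fin_cases i <;> fin_cases j
    exacts [h.ξ_ξ x hx, h.ξ_e x hx, h.ξ_φe x hx, (S.g.symm x _ _).trans (h.ξ_e x hx), h.e_e x hx,
      h.e_φe x hx, (S.g.symm x _ _).trans (h.ξ_φe x hx), (S.g.symm x _ _).trans (h.e_φe x hx),
      h.φe_φe x hx]
  card_eq := by rw [hE, Fintype.card_fin]

include hU hE in
/-- A `φ`-basis is a Reeb frame for smooth structure functions. -/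
lemma exists_isReebFrameOn : ∃ A a₁ a₃ a₄ a₅ : M → ℝ,
    S.g.IsReebFrameOn S.ξ e (fun x ↦ S.φ x (e x)) A (fun x ↦ a₃ x - a₁ x + 1)
      (fun x ↦ a₃ x + a₁ x + 1) a₄ (fun x ↦ -a₅ x) U := by
  have hF := h.isOrthonormalFrameOn hE
  set f : ∀ x : M, TangentSpace 𝓘(ℝ, E) x := fun x ↦ S.φ x (e x) with hf
  have sξ : SmoothFieldOn S.ξ U := hF.smooth 0
  have se : SmoothFieldOn e U := h.smooth
  have sf : SmoothFieldOn f U := h.smooth_φ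
  have hexp (v : ∀ x : M, TangentSpace 𝓘(ℝ, E) x) (x : M) (hx : x ∈ U) :
      v x = S.η x (v x) • S.ξ x + S.g.inner x (v x) (e x) • e x
        + (-S.g.inner x (v x) (f x)) • f x := by
    have h1 := hF.eq_sum hx (v x)
    rw [Fin.sum_univ_three] at h1
    change v x = ((1 : ℝ) * S.g.inner x (v x) (S.ξ x)) • S.ξ x
      + ((1 : ℝ) * S.g.inner x (v x) (e x)) • e x
      + ((-1 : ℝ) * S.g.inner x (v x) (f x)) • f x at h1
    rw [S.g.symm x (v x) (S.ξ x), S.inner_ξ_left] at h1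
    simpa only [one_mul, neg_one_mul] using h1
  have ηξ : ∀ x ∈ U, S.η x (S.ξ x) = 1 := fun x _ ↦ S.η_ξ x
  have ηe : ∀ x ∈ U, S.η x (e x) = 0 := fun x hx ↦ by rw [← S.inner_ξ_left, h.ξ_e x hx]
  have ηf : ∀ x ∈ U, S.η x (f x) = 0 := fun x _ ↦ S.η_φ x _
  have hff : ∀ x ∈ U, S.φ x (f x) = e x := fun x hx ↦ by
    rw [hf, S.φ_φ, ηe x hx, zero_smul, sub_zero]
  have s1 := sξ.bracket se hU
  have s2 := sξ.bracket sf hU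
  have s3 := se.bracket sf hU
  have b1 : ∀ x ∈ U, fieldBracket S.ξ e x = S.g.inner x (fieldBracket S.ξ e x) (e x) • e x
      + (-S.g.inner x (fieldBracket S.ξ e x) (f x)) • f x := fun x hx ↦ by
    conv_lhs => rw [hexp (fieldBracket S.ξ e) x hx, S.η_fieldBracket hU hx sξ se ηξ ηe, h.ξ_φe x hx]
    simp
  have b2 : ∀ x ∈ U, fieldBracket S.ξ f x = S.g.inner x (fieldBracket S.ξ f x) (e x) • e x
      + (-S.g.inner x (fieldBracket S.ξ f x) (f x)) • f x := fun x hx ↦ by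
    conv_lhs => rw [hexp (fieldBracket S.ξ f) x hx, S.η_fieldBracket hU hx sξ sf ηξ ηf, hff x hx, h.ξ_e x hx]
    simp
  have b3 : ∀ x ∈ U, fieldBracket e f x = (-2 : ℝ) • S.ξ x
      + S.g.inner x (fieldBracket e f x) (e x) • e x
      + (-S.g.inner x (fieldBracket e f x) (f x)) • f x := fun x hx ↦ by
    conv_lhs => rw [hexp (fieldBracket e f) x hx, S.η_fieldBracket hU hx se sf ηe ηf, hff x hx, h.e_e x hx,
      mul_one]
  have c1 := S.g.contMDiffOn_inner s1 se
  have c2 := (S.g.contMDiffOn_inner s1 sf).neg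
  have c3 := S.g.contMDiffOn_inner s2 se
  have c4 := (S.g.contMDiffOn_inner s2 sf).neg
  have c5 := S.g.contMDiffOn_inner s3 se
  have c6 := (S.g.contMDiffOn_inner s3 sf).neg
  set A : M → ℝ := fun x ↦ S.g.inner x (fieldBracket S.ξ e x) (e x)
  set B : M → ℝ := fun x ↦ -S.g.inner x (fieldBracket S.ξ e x) (f x)
  set C : M → ℝ := fun x ↦ S.g.inner x (fieldBracket S.ξ f x) (e x)
  -- Here `a₁` and `a₃` solve `B = a₃ - a₁ + 1` and `C = a₃ + a₁ + 1`.
  refine ⟨A, fun x ↦ (C x - B x) / 2, fun x ↦ (C x + B x) / 2 - 1,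
    fun x ↦ S.g.inner x (fieldBracket e f x) (e x),
    fun x ↦ S.g.inner x (fieldBracket e f x) (f x), ?_⟩
  have eB : (fun x ↦ (C x + B x) / 2 - 1 - (C x - B x) / 2 + 1) = B := by ext x; ring
  have eC : (fun x ↦ (C x + B x) / 2 - 1 + (C x - B x) / 2 + 1) = C := by ext x; ring
  rw [eB, eC]
  refine ⟨hU, hF, c1, c2, c3, c5, c6, b1, fun x hx ↦ ?_, b3⟩
  obtain ⟨hD, -⟩ := hF.jacobi hU hx c1 c2 c3 c4 c5 c6 b1 b2 b3
  rw [← hD]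
  exact b2 x hx

end IsPhiBasisOn

end PhiBasis

end ParacontactMetricStructure

/-! ### The harmonic equations and the choice of sign -/

/-- A continuous function vanishes if it vanishes off the frontier of the zero set of `a`. -/
lemma eq_zero_of_forall_notMem_frontier {M : Type*} [TopologicalSpace M] {a R : M → ℝ} {U : Set M}
    {p : M} (hU : IsOpen U) (hp : p ∈ U) (hR : ContinuousAt R p)
    (h : ∀ y ∈ U, (a y ≠ 0 ∨ ∀ᶠ z in 𝓝 y, a z = 0) → R y = 0) : R p = 0 := by
  by_contra hne
  -- If `R p ≠ 0`, then `R ≠ 0` near `p`, which forces `a = 0` near `p`; so `p` itself is a point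
  -- where `R` was assumed to vanish.
  refine hne (h p hp (Or.inr ?_))
  filter_upwards [hR.eventually_ne hne, hU.mem_nhds hp] with y hy hyU
  by_contra hay
  exact hy (h y hyU (Or.inl hay))

namespace PseudoRiemannianMetric.IsReebFrameOn

section Harmonic

set_option linter.unusedSectionVars false

variable {E : Type*} [NormedAddCommGroup E] [NormedSpace ℝ E] [FiniteDimensional ℝ E]
  {M : Type*} [TopologicalSpace M] [ChartedSpace E M] [IsManifold 𝓘(ℝ, E) ∞ M]
  {g : PseudoRiemannianMetric E M}
  {X ξ e f : ∀ x : M, TangentSpace 𝓘(ℝ, E) x} {U : Set M} {p : M}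
  {A a₁ a₃ a₄ a₅ ε : M → ℝ}
  (h : g.IsReebFrameOn ξ e f A (fun x ↦ a₃ x - a₁ x + 1) (fun x ↦ a₃ x + a₁ x + 1) a₄
    (fun x ↦ -a₅ x) U)
include h

lemma smooth_a₁ : ContMDiffOn 𝓘(ℝ, E) 𝓘(ℝ, ℝ) ∞ a₁ U :=
  ((contMDiffOn_const (c := (2 : ℝ)⁻¹)).mul (h.smooth_C.sub h.smooth_B)).congr fun x _ ↦ by
    change a₁ x = 2⁻¹ * ((a₃ x + a₁ x + 1) - (a₃ x - a₁ x + 1))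
    ring

lemma smooth_a₃ : ContMDiffOn 𝓘(ℝ, E) 𝓘(ℝ, ℝ) ∞ a₃ U :=
  (h.smooth_C.sub (h.smooth_a₁.add (contMDiffOn_const (c := (1 : ℝ))))).congr fun x _ ↦ by
    change a₃ x = (a₃ x + a₁ x + 1) - (a₁ x + 1)
    ring

lemma smooth_a₅ : ContMDiffOn 𝓘(ℝ, E) 𝓘(ℝ, ℝ) ∞ a₅ U :=
  h.smooth_β.neg.congr fun x _ ↦ (neg_neg (a₅ x)).symm

lemma fieldDeriv_B (hp : p ∈ U) :
    fieldDeriv X (fun x ↦ a₃ x - a₁ x + 1) p = fieldDeriv X a₃ p - fieldDeriv X a₁ p := by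
  have d1 := h.smooth_a₁.mdifferentiableAt_of_isOpen h.isOpen hp
  have d3 := h.smooth_a₃.mdifferentiableAt_of_isOpen h.isOpen hp
  rw [fieldDeriv_add X (f := fun x ↦ a₃ x - a₁ x) (h := fun _ ↦ 1) (d3.sub d1)
     mdifferentiableAt_const, fieldDeriv_const,
    add_zero]
  simp [fieldDeriv, mvfderiv_fun_sub d3 d1]

lemma fieldDeriv_C (hp : p ∈ U) :
    fieldDeriv X (fun x ↦ a₃ x + a₁ x + 1) p = fieldDeriv X a₃ p + fieldDeriv X a₁ p := by
  have d1 := h.smooth_a₁.mdifferentiableAt_of_isOpen h.isOpen hp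
  have d3 := h.smooth_a₃.mdifferentiableAt_of_isOpen h.isOpen hp
  rw [fieldDeriv_add X (f := fun x ↦ a₃ x + a₁ x) (h := fun _ ↦ 1) (d3.add d1)
     mdifferentiableAt_const, fieldDeriv_const,
    add_zero, fieldDeriv_add X d3 d1]

lemma continuousAt_fieldDeriv (hp : p ∈ U) (hX : SmoothFieldOn X U) {a : M → ℝ}
    (ha : ContMDiffOn 𝓘(ℝ, E) 𝓘(ℝ, ℝ) ∞ a U) : ContinuousAt (fieldDeriv X a) p :=
  (h.frame.contMDiffOn_fieldDeriv h.isOpen hX ha).continuousOn.continuousAt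
    (h.isOpen.mem_nhds hp)

/-- The trace of `L_ξ ∇` vanishes at a point iff three scalar equations hold there. -/
lemma traceLieConnection_eq_zero_iff (hp : p ∈ U) :
    g.traceLieConnection ξ p = 0 ↔ A p ^ 2 = a₁ p ^ 2 ∧
      fieldDeriv e A p = fieldDeriv f a₁ p + 2 * a₁ p * a₄ p - 2 * A p * a₅ p ∧
      fieldDeriv f A p = fieldDeriv e a₁ p - 2 * A p * a₄ p + 2 * a₁ p * a₅ p := by
  rw [h.traceLieConnection_eq hp]
  simp only [h.fieldDeriv_B hp, h.fieldDeriv_C hp]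
  constructor
  · intro h0
    obtain ⟨h1, h2, h3⟩ := h.frame.coeff_eq hp (a' := 0) (b' := 0) (c' := 0)
      (h0.trans (by simp))
    refine ⟨?_, ?_, ?_⟩ <;> linarith
  · rintro ⟨h1, h2, h3⟩
    rw [h2, h3, show (4 : ℝ) * A p ^ 2 = 4 * a₁ p ^ 2 by rw [h1]]
    module

/-- Solved for `ξ(a₄)` and `ξ(a₅)` so that the trace equations can be substituted for `f(A)` and
`e(A)`. -/
lemma jacobi_coefficients (hp : p ∈ U) :
    fieldDeriv ξ a₄ p = -A p * a₄ p + a₅ p * (a₃ p + a₁ p + 1) - fieldDeriv f A p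
        + fieldDeriv e a₃ p + fieldDeriv e a₁ p ∧
      fieldDeriv ξ a₅ p = a₄ p * (a₃ p - a₁ p + 1) + A p * a₅ p + fieldDeriv f a₃ p
        - fieldDeriv f a₁ p + fieldDeriv e A p := by
  obtain ⟨h1, h2⟩ := h.jacobi hp
  simp only [h.fieldDeriv_B hp, h.fieldDeriv_C hp, fieldDeriv_neg] at h1 h2
  constructor <;> linarith

omit h in
lemma fieldDeriv_of_eventually_eq_smul {a b : M → ℝ} {c : ℝ}
    (hab : ∀ᶠ y in 𝓝 p, a y = c * b y) (hb : MDifferentiableAt 𝓘(ℝ, E) 𝓘(ℝ, ℝ) b p) :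
    fieldDeriv X a p = c * fieldDeriv X b p := by
  rw [fieldDeriv_congr hab, fieldDeriv_mul X (f := fun _ ↦ c) mdifferentiableAt_const hb,
    fieldDeriv_const, mul_zero, add_zero]

/-- If `A = -ε a₁` with `ε = ±1` near a point, the equations of `traceLieConnection_eq_zero_iff`
reduce to a single one. -/
lemma traceLieConnection_eq_zero_iff_of_eventually (hp : p ∈ U) {s : ℝ} (hs : s = 1 ∨ s = -1)
    (hA : ∀ᶠ y in 𝓝 p, A y = -s * a₁ y) :
    g.traceLieConnection ξ p = 0 ↔
      fieldDeriv e a₁ p + s * fieldDeriv f a₁ p + 2 * s * a₁ p * a₄ p + 2 * a₁ p * a₅ p = 0 := by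
  have d1 := h.smooth_a₁.mdifferentiableAt_of_isOpen h.isOpen hp
  rw [h.traceLieConnection_eq_zero_iff hp, fieldDeriv_of_eventually_eq_smul hA d1,
    fieldDeriv_of_eventually_eq_smul hA d1, hA.self_of_nhds]
  -- As `s² = 1`, the equations for `e(A)` and `f(A)` are the stated one multiplied by `s` and by
  -- `1`.
  rcases hs with rfl | rfl
  · refine ⟨fun ⟨_, h2, _⟩ ↦ by linarith, fun h0 ↦ ⟨by ring, by linarith, by linarith⟩⟩
  · refine ⟨fun ⟨_, h2, _⟩ ↦ by linarith, fun h0 ↦ ⟨by ring, by linarith, by linarith⟩⟩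

/-- The trace of `L_ξ ∇` vanishes if `A = -ε a₁` and the first order equation for `a₁` holds, for
a sign `ε` which may jump only on the frontier of the zero set of `a₁`. -/
theorem traceLieConnection_eq_zero (hp : p ∈ U) (hε : ∀ x ∈ U, ε x = 1 ∨ ε x = -1)
    (hloc : ∀ x ∈ U, (a₁ x ≠ 0 ∨ ∀ᶠ y in 𝓝 x, a₁ y = 0) → ∀ᶠ y in 𝓝 x, ε y = ε x)
    (hA : ∀ x ∈ U, A x = -(ε x * a₁ x))
    (ha : ∀ x ∈ U, fieldDeriv e a₁ x + ε x * fieldDeriv f a₁ x + 2 * ε x * a₁ x * a₄ x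
      + 2 * a₁ x * a₅ x = 0) :
    g.traceLieConnection ξ p = 0 := by
  have hU := h.isOpen
  have hgood (y : M) (hy : y ∈ U) (hy' : a₁ y ≠ 0 ∨ ∀ᶠ z in 𝓝 y, a₁ z = 0) :
      g.traceLieConnection ξ y = 0 := by
    rw [h.traceLieConnection_eq_zero_iff_of_eventually hy (hε y hy) ?_]
    · exact ha y hy
    · filter_upwards [hloc y hy hy', hU.mem_nhds hy] with z hz hzU
      rw [hA z hzU, hz, neg_mul]
  have c1 : ContinuousAt a₁ p := h.smooth_a₁.continuousOn.continuousAt (hU.mem_nhds hp)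
  have cA : ContinuousAt A p := h.smooth_A.continuousOn.continuousAt (hU.mem_nhds hp)
  have c4 : ContinuousAt a₄ p := h.smooth_α.continuousOn.continuousAt (hU.mem_nhds hp)
  have c5 : ContinuousAt a₅ p := h.smooth_a₅.continuousOn.continuousAt (hU.mem_nhds hp)
  have ceA := h.continuousAt_fieldDeriv hp h.smooth_e h.smooth_A
  have cfA := h.continuousAt_fieldDeriv hp h.smooth_f h.smooth_A
  have ce1 := h.continuousAt_fieldDeriv hp h.smooth_e h.smooth_a₁
  have cf1 := h.continuousAt_fieldDeriv hp h.smooth_f h.smooth_a₁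
  rw [h.traceLieConnection_eq_zero_iff hp]
  refine ⟨?_, ?_, ?_⟩
  · rw [hA p hp]
    rcases hε p hp with hs | hs <;> rw [hs] <;> ring
  -- Unlike the equation containing `ε`, the trace equations have continuous terms, so they extend
  -- to the frontier points where `ε` may jump.
  · refine sub_eq_zero.1 (eq_zero_of_forall_notMem_frontier (a := a₁)
      (R := fun y ↦ fieldDeriv e A y - (fieldDeriv f a₁ y + 2 * a₁ y * a₄ y - 2 * A y * a₅ y))
      hU hp (by fun_prop) fun y hy hy' ↦ ?_)
    exact sub_eq_zero.2 ((h.traceLieConnection_eq_zero_iff hy).1 (hgood y hy hy')).2.1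
  · refine sub_eq_zero.1 (eq_zero_of_forall_notMem_frontier (a := a₁)
      (R := fun y ↦ fieldDeriv f A y - (fieldDeriv e a₁ y - 2 * A y * a₄ y + 2 * a₁ y * a₅ y))
      hU hp (by fun_prop) fun y hy hy' ↦ ?_)
    exact sub_eq_zero.2 ((h.traceLieConnection_eq_zero_iff hy).1 (hgood y hy hy')).2.2

/-- Where the trace of `L_ξ ∇` vanishes, there is a sign `ε` with `A = -ε a₁`, which jumps only on
the frontier of the zero set of `a₁`. -/
theorem exists_sign (h0 : ∀ x ∈ U, g.traceLieConnection ξ x = 0) :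
    ∃ ε : M → ℝ, (∀ x, ε x = 1 ∨ ε x = -1) ∧
      (∀ x ∈ U, (a₁ x ≠ 0 ∨ ∀ᶠ y in 𝓝 x, a₁ y = 0) → ∀ᶠ y in 𝓝 x, ε y = ε x) ∧
      (∀ x ∈ U, A x = -(ε x * a₁ x)) ∧
      ∀ x ∈ U, fieldDeriv e a₁ x + ε x * fieldDeriv f a₁ x + 2 * ε x * a₁ x * a₄ x
        + 2 * a₁ x * a₅ x = 0 := by
  classical
  have hU := h.isOpen
  let G (s : ℝ) (x : M) : ℝ := fieldDeriv e a₁ x + s * fieldDeriv f a₁ x + 2 * s * a₁ x * a₄ x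
    + 2 * a₁ x * a₅ x
  -- The sign will be `1` exactly where `P` holds. Where `a₁ = 0` the relation `A = -ε a₁` leaves
  -- `ε` undetermined, and the equation `G ε = 0` has to decide.
  let P (x : M) : Prop := A x = -a₁ x ∧ G 1 x = 0
  have c1 (x : M) (hx : x ∈ U) : ContinuousAt a₁ x :=
    h.smooth_a₁.continuousOn.continuousAt (hU.mem_nhds hx)
  have cA (x : M) (hx : x ∈ U) : ContinuousAt A x :=
    h.smooth_A.continuousOn.continuousAt (hU.mem_nhds hx)
  have hsq (x : M) (hx : x ∈ U) : A x ^ 2 = a₁ x ^ 2 :=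
    ((h.traceLieConnection_eq_zero_iff hx).1 (h0 x hx)).1
  have hG (s : ℝ) (hs : s = 1 ∨ s = -1) (x : M) (hx : x ∈ U)
      (hA : ∀ᶠ y in 𝓝 x, A y = -s * a₁ y) : G s x = 0 :=
    (h.traceLieConnection_eq_zero_iff_of_eventually hx hs hA).1 (h0 x hx)
  have hzero (x : M) (hx : x ∈ U) (hz : ∀ᶠ y in 𝓝 x, a₁ y = 0) (s : ℝ) :
      ∀ᶠ y in 𝓝 x, A y = -s * a₁ y := by
    filter_upwards [hz, hU.mem_nhds hx] with y hy hyU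
    have := hsq y hyU
    rw [hy] at this ⊢
    simpa using this
  have hlocal (s : ℝ) (hs : s = 1 ∨ s = -1) (x : M) (hx : x ∈ U) (hne : a₁ x ≠ 0)
      (hA : A x = -s * a₁ x) : ∀ᶠ y in 𝓝 x, A y = -s * a₁ y := by
    have hss : s * s = 1 := by rcases hs with rfl | rfl <;> norm_num
    have hs0 : s ≠ 0 := by rintro rfl; norm_num at hss
    -- In `(A - s a₁)(A + s a₁) = 0` the first factor stays nonzero near `x`, so the second vanishes
    -- there.
    have h1 : A x - s * a₁ x ≠ 0 := by
      rw [hA, show -s * a₁ x - s * a₁ x = -2 * s * a₁ x by ring]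
      exact mul_ne_zero (mul_ne_zero (by norm_num) hs0) hne
    have h2 : ContinuousAt (fun y ↦ A y - s * a₁ y) x :=
      (cA x hx).sub (continuousAt_const.mul (c1 x hx))
    filter_upwards [h2.eventually_ne h1, hU.mem_nhds hx] with y hy hyU
    have h3 : (A y - s * a₁ y) * (A y + s * a₁ y) = 0 := by
      linear_combination hsq y hyU - a₁ y ^ 2 * hss
    linarith [(mul_eq_zero.1 h3).resolve_left hy]
  have hsplit (x : M) (hx : x ∈ U) : A x = -1 * a₁ x ∨ A x = - -1 * a₁ x := by
    rcases sq_eq_sq_iff_eq_or_eq_neg.1 (hsq x hx) with h1 | h1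
    · exact Or.inr (by rw [h1]; ring)
    · exact Or.inl (by rw [h1]; ring)
  -- Off the frontier one of the two equations holds; the product is continuous and hence vanishes
  -- on all of `U`.
  have hprod (x : M) (hx : x ∈ U) : G 1 x * G (-1) x = 0 := by
    have ce1 := h.continuousAt_fieldDeriv hx h.smooth_e h.smooth_a₁
    have cf1 := h.continuousAt_fieldDeriv hx h.smooth_f h.smooth_a₁
    have c1 := c1 x hx
    have c4 : ContinuousAt a₄ x := h.smooth_α.continuousOn.continuousAt (hU.mem_nhds hx)
    have c5 : ContinuousAt a₅ x := h.smooth_a₅.continuousOn.continuousAt (hU.mem_nhds hx)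
    refine eq_zero_of_forall_notMem_frontier (a := a₁) (R := fun x ↦ G 1 x * G (-1) x) hU hx
      (by simp only [G]; fun_prop) fun y hy hy' ↦ ?_
    rcases hy' with hne | hz
    · rcases hsplit y hy with hA | hA
      · exact mul_eq_zero_of_left (hG 1 (Or.inl rfl) y hy (hlocal 1 (Or.inl rfl) y hy hne hA)) _
      · exact mul_eq_zero_of_right _
          (hG (-1) (Or.inr rfl) y hy (hlocal (-1) (Or.inr rfl) y hy hne hA))
    · exact mul_eq_zero_of_left (hG 1 (Or.inl rfl) y hy (hzero y hy hz 1)) _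
  have hP1 (x : M) (hx : x ∈ U) (hA : ∀ᶠ y in 𝓝 x, A y = -1 * a₁ y) : ∀ᶠ y in 𝓝 x, P y := by
    filter_upwards [hA.eventually_nhds, hU.mem_nhds hx] with y hy hyU
    exact ⟨by simpa using hy.self_of_nhds, hG 1 (Or.inl rfl) y hyU hy⟩
  have hcase (x : M) (hx : x ∈ U) (hnP : ¬ P x) : A x = a₁ x ∧ G (-1) x = 0 := by
    by_cases hne : a₁ x = 0
    -- At a zero of `a₁` the first half of `P` is automatic, so failure of `P` means `G 1 x ≠ 0`,
    -- and the product forces `G (-1) x = 0`.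
    · have hA : A x = 0 := by simpa [hne] using hsq x hx
      refine ⟨by rw [hA, hne], (mul_eq_zero.1 (hprod x hx)).resolve_left fun h1 ↦ hnP ⟨?_, h1⟩⟩
      rw [hA, hne, neg_zero]
    · rcases hsplit x hx with hA | hA
      · exact absurd (hP1 x hx (hlocal 1 (Or.inl rfl) x hx hne hA)).self_of_nhds hnP
      · exact ⟨by rw [hA]; ring,
          hG (-1) (Or.inr rfl) x hx (hlocal (-1) (Or.inr rfl) x hx hne hA)⟩
  refine ⟨fun x ↦ if P x then 1 else -1, fun x ↦ ?_, fun x hx hx' ↦ ?_, fun x hx ↦ ?_,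
    fun x hx ↦ ?_⟩
  · by_cases hPx : P x <;> simp [hPx]
  · by_cases hPx : P x
    · have hev : ∀ᶠ y in 𝓝 x, P y := by
        rcases hx' with hne | hz
        · exact hP1 x hx (hlocal 1 (Or.inl rfl) x hx hne (by rw [hPx.1]; ring))
        · exact hP1 x hx (hzero x hx hz 1)
      filter_upwards [hev] with y hy
      rw [if_pos hy, if_pos hPx]
    -- Where `a₁` vanishes nearby, `P` holds; so here `a₁ x ≠ 0`. Then `A + a₁ = 2 a₁ ≠ 0` at `x`,
    -- and `A + a₁` stays nonzero nearby, which excludes `P`.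
    · have hne : a₁ x ≠ 0 := hx'.resolve_right fun hz ↦
        hPx (hP1 x hx (hzero x hx hz 1)).self_of_nhds
      have hA : A x = a₁ x := (hcase x hx hPx).1
      have hsum : A x + a₁ x ≠ 0 := by
        rw [hA]
        exact fun h2 ↦ hne (by linarith)
      filter_upwards [((cA x hx).add (c1 x hx)).eventually_ne hsum] with y hy
      rw [if_neg hPx, if_neg fun hPy : P y ↦ hy (by
        rw [Pi.add_apply, hPy.1, neg_add_cancel])]
  · by_cases hPx : P x
    · simp only [if_pos hPx, one_mul]
      exact hPx.1
    · simp only [if_neg hPx, (hcase x hx hPx).1]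
      ring
  · by_cases hPx : P x
    · simp only [if_pos hPx]; exact hPx.2
    · simp only [if_neg hPx]; exact (hcase x hx hPx).2

end Harmonic

end PseudoRiemannianMetric.IsReebFrameOn

/-! ### The characterization of harmonic Reeb fields -/

theorem mainTheorem8 {M : Type*} [TopologicalSpace M] [T2Space M] [SecondCountableTopology M]
    [ChartedSpace (EuclideanSpace ℝ (Fin 3)) M] [IsManifold 𝓘(ℝ, EuclideanSpace ℝ (Fin 3)) ∞ M]
    (S : ParacontactMetricStructure (EuclideanSpace ℝ (Fin 3)) M) :
    S.g.IsInfinitesimalHarmonic S.ξ ↔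
      ∀ p : M, ∃ (U : Set M) (e : ∀ x : M, TangentSpace 𝓘(ℝ, EuclideanSpace ℝ (Fin 3)) x)
        (ε a₁ a₃ a₄ a₅ : M → ℝ),
        IsOpen U ∧ p ∈ U ∧ S.IsPhiBasisOn e U ∧
        ContMDiffOn 𝓘(ℝ, EuclideanSpace ℝ (Fin 3)) 𝓘(ℝ, ℝ) ∞ a₁ U ∧
        ContMDiffOn 𝓘(ℝ, EuclideanSpace ℝ (Fin 3)) 𝓘(ℝ, ℝ) ∞ a₃ U ∧
        ContMDiffOn 𝓘(ℝ, EuclideanSpace ℝ (Fin 3)) 𝓘(ℝ, ℝ) ∞ a₄ U ∧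
        ContMDiffOn 𝓘(ℝ, EuclideanSpace ℝ (Fin 3)) 𝓘(ℝ, ℝ) ∞ a₅ U ∧
        (∀ x ∈ U, ε x = 1 ∨ ε x = -1) ∧
        (∀ x ∈ U, (a₁ x ≠ 0 ∨ ∀ᶠ y in 𝓝 x, a₁ y = 0) → ∀ᶠ y in 𝓝 x, ε y = ε x) ∧
        (∀ x ∈ U,
          fieldBracket S.ξ e x
              = (-(ε x * a₁ x)) • e x + (a₃ x - a₁ x + 1) • S.φ x (e x) ∧
          fieldBracket S.ξ (fun y ↦ S.φ y (e y)) x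
              = (a₃ x + a₁ x + 1) • e x + (ε x * a₁ x) • S.φ x (e x) ∧
          fieldBracket e (fun y ↦ S.φ y (e y)) x
              = (-2 : ℝ) • S.ξ x + a₄ x • e x - a₅ x • S.φ x (e x)) ∧
        (∀ x ∈ U,
          fieldDeriv S.ξ a₄ x - fieldDeriv e a₃ x + ε x * a₁ x * a₄ x
              - a₅ x * (a₃ x - a₁ x + 1) = 0 ∧
          fieldDeriv S.ξ a₅ x - fieldDeriv (fun y ↦ S.φ y (e y)) a₃ x - ε x * a₁ x * a₅ x
              - a₄ x * (a₃ x + a₁ x + 1) = 0 ∧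
          fieldDeriv e a₁ x + ε x * fieldDeriv (fun y ↦ S.φ y (e y)) a₁ x
              + 2 * ε x * a₁ x * a₄ x + 2 * a₁ x * a₅ x = 0) := by
  have hE : Module.finrank ℝ (EuclideanSpace ℝ (Fin 3)) = 3 := finrank_euclideanSpace_fin
  constructor
  · intro h0 p
    obtain ⟨U, e, hU, hp, he⟩ := S.exists_isPhiBasisOn (by rw [hE]; norm_num) p
    obtain ⟨A, a₁, a₃, a₄, a₅, h⟩ := he.exists_isReebFrameOn hU hE
    obtain ⟨ε, hε, hloc, hA, ha⟩ := h.exists_sign fun x _ ↦ h0 x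
    refine ⟨U, e, ε, a₁, a₃, a₄, a₅, hU, hp, he, h.smooth_a₁, h.smooth_a₃, h.smooth_α, h.smooth_a₅,
      fun x _ ↦ hε x, hloc, fun x hx ↦ ⟨?_, ?_, ?_⟩, fun x hx ↦ ?_⟩
    · rw [h.bracket_ξe x hx, hA x hx]
    · rw [h.bracket_ξf x hx, hA x hx, neg_neg]
    · rw [h.bracket_ef x hx, neg_smul (a₅ x), sub_eq_add_neg]
    · obtain ⟨-, h2, h3⟩ := (h.traceLieConnection_eq_zero_iff hx).1 (h0 x)
      obtain ⟨j1, j2⟩ := h.jacobi_coefficients hx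
      rw [h3] at j1
      rw [h2] at j2
      rw [hA x hx] at j1 j2
      exact ⟨by linarith, by linarith, ha x hx⟩
  · intro h0 p
    obtain ⟨U, e, ε, a₁, a₃, a₄, a₅, hU, hp, he, s1, s3, s4, s5, hε, hloc, hbr, heq⟩ := h0 p
    have hF := he.isOrthonormalFrameOn hE
    have sξ : SmoothFieldOn S.ξ U := hF.smooth 0
    -- Although `ε` may jump, `-ε a₁` is smooth, being the `e`-component of `[ξ, e]`.
    have hA : ∀ x ∈ U, -(ε x * a₁ x) = S.g.inner x (fieldBracket S.ξ e x) (e x) := fun x hx ↦ by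
      rw [(hbr x hx).1]
      simp only [map_add, map_smul, add_apply, smul_apply, smul_eq_mul, he.e_e x hx,
        S.g.symm x (S.φ x (e x)) (e x), he.e_φe x hx]
      ring
    have h : S.g.IsReebFrameOn S.ξ e (fun x ↦ S.φ x (e x)) (fun x ↦ -(ε x * a₁ x))
        (fun x ↦ a₃ x - a₁ x + 1) (fun x ↦ a₃ x + a₁ x + 1) a₄ (fun x ↦ -a₅ x) U :=
      { isOpen := hU
        frame := hF
        smooth_A := (S.g.contMDiffOn_inner (sξ.bracket he.smooth hU) he.smooth).congr hA
        smooth_B := (s3.sub s1).add contMDiffOn_const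
        smooth_C := (s3.add s1).add contMDiffOn_const
        smooth_α := s4
        smooth_β := s5.neg
        bracket_ξe := fun x hx ↦ (hbr x hx).1
        bracket_ξf := fun x hx ↦ by rw [(hbr x hx).2.1, neg_neg]
        bracket_ef := fun x hx ↦ by rw [(hbr x hx).2.2, neg_smul (a₅ x), sub_eq_add_neg] }
    exact h.traceLieConnection_eq_zero hp hε hloc (fun _ _ ↦ rfl) fun x hx ↦ (heq x hx).2.2
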